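/- Let $p\equiv 1\pmod 4$ be prime, $p=4f+1$, let $g$ be a primitive element of $\mathbb F_p$ (a generator of $\mathbb F_p^*$), $m\ge 2$ an integer, $a\in\mathbb F_p$ and $h\in\{0,1,2,3\}$. Let $\rho$ be the quadratic character of $\mathbb F_p$ and $\chi$ the multiplicative character of order $4$ of $\mathbb F_p$ with $\chi(g)=i$ (both are $0$ at $0$). Let $a_4,b_4\in\mathbb Z$ satisfy $$a_4^2+b_4^2=p,\qquad a_4\equiv-\Bigl(\tfrac 2p\Bigr)\pmod 4,\qquad b_4\equiv a_4\,g^{(p-1)/4}\pmod p,$$ and put $\pi=(-1)^f(a_4+ib_4)\in\mathbb Z[i]$. **Values of $N_t$.** For $t\mid m$ let $N_t$ be the number of $x\in\mathbb F_{p^t}\subseteq\mathbb F_{p^m}$ with $\mathrm{Tr}_{\mathbb F_{p^m}/\mathbb F_p}(x)=a$ and $\mathrm{Norm}_{\mathbb F_{p^m}/\mathbb F_p}(x)\in g^h\langle g^4\rangle$. Let $d=\gcd(m/t,4)$ and $l=\gcd(t,4/d)$, and assume that $p\nmid m/t$ and $d\mid h$. Let $i_0$ be the solution of $\frac{m}{dt}\,i_0\equiv\frac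 hd\pmod{4/d}$ with $0\le i_0<4/d$; for $a\neq 0$ let $a_0=-\frac{m/t}{a}\in\mathbb F_p$ ($m/t$ being an integer), and for odd $t$ put $$Q_{t,4}=\begin{cases}p^{\frac{t-1}4}\,\pi^{\frac{t-1}2}\,\overline{\chi}(-a_0)\,i^{i_0}&\text{if }t\equiv1\pmod 4,\\ (-1)^f p^{\frac{t-3}4}\,\pi^{\frac{t+1}2}\,\chi(-a_0)\,i^{i_0}&\text{if }t\equiv3\pmod 4.\end{cases}$$ Then $(d,l)$ is one of $(1,1),(1,2),(1,4),(2,1),(2,2),(4,1)$, and $N_t$ is as follows. If $a=0$: - $(d,l)=(1,1)$: $N_t=\frac14\bigl(p^{t-1}-1\bigr)$ - $(d,l)=(1,2)$: $N_t=\frac14\bigl(p^{t-1}-1-(-1)^{i_0}p^{\frac{t-2}2}(p-1)\bigr)$ - $(d,l)=(1,4)$: $N_t=\frac14\bigl(p^{t-1}-1-(-1)^{i_0}p^{\frac{t-4}4}(p-1)\bigl(p^{\frac t4}+2\,\mathrm{Re}(\pi^{\frac t2}i^{i_0})\bigr)\bigr)$ - $(d,l)=(2,1)$: $N_t=\frac12\bigl(p^{t-1}-1\bigr)$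 - $(d,l)=(2,2)$: $N_t=\frac12\bigl(p^{t-1}-1-(-1)^{i_0}p^{\frac{t-2}2}(p-1)\bigr)$ - $(d,l)=(4,1)$: $N_t=p^{t-1}-1$ If $a\ne0$: - $(d,l)=(1,1)$: $N_t=\frac14\bigl(p^{t-1}+(-1)^{i_0}\bigl(p^{\frac{t-1}2}\rho(a_0)+2\,\mathrm{Re}\,Q_{t,4}\bigr)\bigr)$ - $(d,l)=(1,2)$: $N_t=\frac14\bigl(p^{t-1}+(-1)^{i_0}p^{\frac{t-2}4}\bigl(p^{\frac{t-2}4}-2\rho(a_0)\,\mathrm{Re}(\pi^{\frac t2}i^{i_0})\bigr)\bigr)$ - $(d,l)=(1,4)$: $N_t=\frac14\bigl(p^{t-1}+(-1)^{i_0}p^{\frac{t-4}4}\bigl(p^{\frac t4}+2\,\mathrm{Re}(\pi^{\frac t2}i^{i_0})\bigr)\bigr)$ - $(d,l)=(2,1)$: $N_t=\frac12\bigl(p^{t-1}+(-1)^{i_0}p^{\frac{t-1}2}\rho(a_0)\bigr)$ - $(d,l)=(2,2)$: $N_t=\frac12\bigl(p^{t-1}+(-1)^{i_0}p^{\frac{t-2}2}\bigr)$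 - $(d,l)=(4,1)$: $N_t=p^{t-1}$ **Values of $P_m(a,4,h)$ for prime $m>2$.** Let $P_m(a,4,h)$ be the number of irreducible polynomials $x^m-ax^{m-1}+\cdots+(-1)^mb\in\mathbb F_p[x]$ with $b\in g^h\langle g^4\rangle$. If $m>2$ is prime, then $$P_m(0,4,h)=\begin{cases}\frac14\bigl(p^{p-2}-1\bigr)&\text{if }m=p,\\ \frac1{4m}\bigl(p^{m-1}-1\bigr)&\text{if }m\ne p,\end{cases}$$ and for $a\neq0$ $$P_p(a,4,h)=\tfrac1{4p}\Bigl(p^{p-1}+(-1)^h\bigl(p^{\frac{p-1}2}\rho(a)+2p^{\frac{p-1}4}\,\mathrm{Re}(\pi^{\frac{p-1}2}\chi(a)i^h)\bigr)\Bigr)\quad\text{if }m=p,$$ $$P_m(a,4,h)=\tfrac1{4m}\Bigl(p^{m-1}-1+(-1)^h\bigl(\rho(a)\bigl(p^{\frac{m-1}2}-\rho(m)\bigr)+2\,\mathrm{Re}\,R_m\bigr)\Bigr)\quad\text{if }m\ne p,$$ where $$R_m=\begin{cases}p^{\frac{m-1}4}\pi^{\frac{m-1}2}\chi(a)i^h-\chi(m^3a)i^h&\text{if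 }m\equiv1\pmod 4,\\ (-1)^fp^{\frac{m-3}4}\pi^{\frac{m+1}2}\overline{\chi}(a)i^h-\chi(m^3a)i^{3h}&\text{if }m\equiv3\pmod 4.\end{cases}$$ -/

import Mathlib

open Polynomial Complex
open scoped ComplexConjugate

/-- The coset `g ^ h ⟨g ^ s⟩` of the subgroup generated by `g ^ s` in `Fˣ`, as a subset of `F`. -/
def powCoset {F : Type*} [Field F] (g : Fˣ) (s h : ℕ) : Set F :=
  {y | ∃ j : ℤ, y = ((g ^ h * (g ^ s) ^ j : Fˣ) : F)}

/-- `P_m(a, s, h)`: the number of irreducible monic polynomials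
`x ^ m - a x ^ (m - 1) + ⋯ + (-1) ^ m b` over `F` with `a` fixed and `b ∈ g ^ h ⟨g ^ s⟩`. -/
noncomputable def irredCount {F : Type*} [Field F] (g : Fˣ) (m : ℕ) (a : F) (s h : ℕ) : ℕ :=
  Set.ncard {f : F[X] | f.Monic ∧ f.natDegree = m ∧ Irreducible f ∧ f.coeff (m - 1) = -a ∧
    ∃ b ∈ powCoset g s h, f.coeff 0 = (-1) ^ m * b}

/-- `S_t(a, s, h)`: for an extension `L / F` (of degree `m`) and its intermediate field `E`
(of degree `t` over `F`), the set of `x ∈ E` whose trace from `L` to `F` is `a` and whose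
norm from `L` to `F` lies in `g ^ h ⟨g ^ s⟩`. -/
def traceNormSet {F L : Type*} [Field F] [Field L] [Algebra F L] (g : Fˣ)
    (E : IntermediateField F L) (a : F) (s h : ℕ) : Set L :=
  {x | x ∈ E ∧ Algebra.trace F L x = a ∧ Algebra.norm F x ∈ powCoset g s h}

/-- `N_t`, the number of elements of `S_t(a, s, h)`. -/
noncomputable def traceNormCount {F L : Type*} [Field F] [Field L] [Algebra F L] (g : Fˣ)
    (E : IntermediateField F L) (a : F) (s h : ℕ) : ℕ :=
  (traceNormSet g E a s h).ncard

/-- `d = gcd (m / t, s)`. -/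
def dParam (m t s : ℕ) : ℕ := Nat.gcd (m / t) s

/-- `l = gcd (t, s / d)`. -/
def lParam (m t s : ℕ) : ℕ := Nat.gcd t (s / dParam m t s)

/-- `i₀` is the solution of `(m / (d t)) i₀ ≡ h / d (mod s / d)` with `0 ≤ i₀ < s / d`
(used when `t ∣ m` and `d ∣ h`, so that all the divisions are exact). -/
def IsIndexZero (m t s h i₀ : ℕ) : Prop :=
  i₀ < s / dParam m t s ∧
    m / (dParam m t s * t) * i₀ ≡ h / dParam m t s [MOD s / dParam m t s]

/-- `π = (-1) ^ f (a₄ + i b₄)` with `f = (p - 1) / 4`. -/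
noncomputable def quarticPi (p : ℕ) (a₄ b₄ : ℤ) : ℂ :=
  (-1) ^ ((p - 1) / 4) * ((a₄ : ℂ) + I * (b₄ : ℂ))

/-- The quadratic character `ρ` of `ZMod p`, with real values. -/
noncomputable def quadChar (p : ℕ) [Fact p.Prime] (x : ZMod p) : ℝ :=
  ((quadraticChar (ZMod p) x : ℤ) : ℝ)

/-- `Q_{t,4}`, which is meant for odd `t` only: the first branch is `t ≡ 1 (mod 4)`, the second
`t ≡ 3 (mod 4)`. -/
noncomputable def quarticQ (p : ℕ) (χ : MulChar (ZMod p) ℂ) (π : ℂ) (t i₀ : ℕ) (a₀ : ZMod p) : ℂ :=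
  if t % 4 = 1 then
    (p : ℂ) ^ ((t - 1) / 4) * π ^ ((t - 1) / 2) * conj (χ (-a₀)) * I ^ i₀
  else
    (-1) ^ ((p - 1) / 4) * (p : ℂ) ^ ((t - 3) / 4) * π ^ ((t + 1) / 2) * χ (-a₀) * I ^ i₀

/-- `R_m` for odd `m`: the first branch is `m ≡ 1 (mod 4)`, the second `m ≡ 3 (mod 4)`. -/
noncomputable def quarticR (p : ℕ) (χ : MulChar (ZMod p) ℂ) (π : ℂ) (m h : ℕ) (a : ZMod p) : ℂ :=
  if m % 4 = 1 then
    (p : ℂ) ^ ((m - 1) / 4) * π ^ ((m - 1) / 2) * χ a * I ^ h - χ ((m : ZMod p) ^ 3 * a) * I ^ h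
  else
    (-1) ^ ((p - 1) / 4) * (p : ℂ) ^ ((m - 3) / 4) * π ^ ((m + 1) / 2) * conj (χ a) * I ^ h
      - χ ((m : ZMod p) ^ 3 * a) * I ^ (3 * h)

/-- The values of `N_t` in the rows of the table with `a = 0`. -/
def TableZero (p t i₀ d l : ℕ) (π : ℂ) (N : ℝ) : Prop :=
  ((d, l) = (1, 1) → N = 1 / 4 * ((p : ℝ) ^ (t - 1) - 1)) ∧
  ((d, l) = (1, 2) →
    N = 1 / 4 * ((p : ℝ) ^ (t - 1) - 1 - (-1) ^ i₀ * (p : ℝ) ^ ((t - 2) / 2) * ((p : ℝ) - 1))) ∧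
  ((d, l) = (1, 4) →
    N = 1 / 4 * ((p : ℝ) ^ (t - 1) - 1 - (-1) ^ i₀ * (p : ℝ) ^ ((t - 4) / 4) * ((p : ℝ) - 1) *
      ((p : ℝ) ^ (t / 4) + 2 * (π ^ (t / 2) * I ^ i₀).re))) ∧
  ((d, l) = (2, 1) → N = 1 / 2 * ((p : ℝ) ^ (t - 1) - 1)) ∧
  ((d, l) = (2, 2) →
    N = 1 / 2 * ((p : ℝ) ^ (t - 1) - 1 - (-1) ^ i₀ * (p : ℝ) ^ ((t - 2) / 2) * ((p : ℝ) - 1))) ∧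
  ((d, l) = (4, 1) → N = (p : ℝ) ^ (t - 1) - 1)

/-- The values of `N_t` in the rows of the table with `a ≠ 0`. -/
def TableNonzero (p : ℕ) [Fact p.Prime] (χ : MulChar (ZMod p) ℂ) (a₀ : ZMod p)
    (t i₀ d l : ℕ) (π : ℂ) (N : ℝ) : Prop :=
  ((d, l) = (1, 1) →
    N = 1 / 4 * ((p : ℝ) ^ (t - 1) + (-1) ^ i₀ *
      ((p : ℝ) ^ ((t - 1) / 2) * quadChar p a₀ + 2 * (quarticQ p χ π t i₀ a₀).re))) ∧
  ((d, l) = (1, 2) →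
    N = 1 / 4 * ((p : ℝ) ^ (t - 1) + (-1) ^ i₀ * (p : ℝ) ^ ((t - 2) / 4) *
      ((p : ℝ) ^ ((t - 2) / 4) - 2 * quadChar p a₀ * (π ^ (t / 2) * I ^ i₀).re))) ∧
  ((d, l) = (1, 4) →
    N = 1 / 4 * ((p : ℝ) ^ (t - 1) + (-1) ^ i₀ * (p : ℝ) ^ ((t - 4) / 4) *
      ((p : ℝ) ^ (t / 4) + 2 * (π ^ (t / 2) * I ^ i₀).re))) ∧
  ((d, l) = (2, 1) →
    N = 1 / 2 * ((p : ℝ) ^ (t - 1) + (-1) ^ i₀ * (p : ℝ) ^ ((t - 1) / 2) * quadChar p a₀)) ∧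
  ((d, l) = (2, 2) →
    N = 1 / 2 * ((p : ℝ) ^ (t - 1) + (-1) ^ i₀ * (p : ℝ) ^ ((t - 2) / 2))) ∧
  ((d, l) = (4, 1) → N = (p : ℝ) ^ (t - 1))

/-!
The numbers `N_t` and `P_m(a, 4, h)` are computed from Gauss sums.

Membership of the norm in `g ^ h ⟨g ^ 4⟩` is detected by the powers of the quartic character `χ`,
which turns four times `N_t` into a combination of the sums `traceFibreSum E (χ ^ j) b` of
`χ ^ j (N x)` over the elements `x` of the intermediate field `E` with a given trace `b`
(`four_mul_traceNormCount`; which powers of `χ` occur depends on the residue of `m / t` modulo `4`).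
The condition on the trace is detected by additive characters, so each such sum is a combination of
Gauss sums over `E` of characters lifted from the prime field. By the Hasse–Davenport relation
(`sum_char_norm_mul_char_trace`) these are, up to sign, powers of Gauss sums over the prime field
(`card_mul_traceFibreSum`).

The Hasse–Davenport relation is proved with the `L`-function of the pair `(χ, ψ)`: the function
`f ↦ χ(N f) ψ(Tr f)` is completely multiplicative on monic polynomials, its generating series is
the polynomial `1 + G(χ, ψ) U`, and the logarithmic derivative of the Euler product of that series
(`natCast_mul_monicSum`) collects the sums over the irreducible polynomials of degree dividing `t`,
that is, over the elements of the extension of degree `t`.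

What remains is the arithmetic of the Gauss sums of `χ` and `χ ^ 2`, which reduces to
`G(χ ^ 2) ^ 2 = p` and `G(χ) ^ 2 = J(χ, χ) G(χ ^ 2)`, and the identification of the Jacobi sum
`J(χ, χ)` with `π` (`jacobiSum_eq_quarticPi`). Here `J(χ, χ) = A + B i` has norm `p`; modulo a prime
above `p` it is `∑ (x (1 - x)) ^ f = 0`, and the symmetry `x ↦ 1 - x` gives `A ≡ -1 (mod 4)`.
These conditions leave only one representation of `p` as a sum of two squares.

Finally, the roots of the irreducible polynomials of prime degree `m` are the elements of the
extension of degree `m` outside the prime field, so that `m P_m(a, 4, h)` is a difference of two of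
the numbers `N_t` (`mul_irredCount_add_traceNormCount_bot`).
-/

/-! ### Monic polynomials over a finite field -/

section MonicPolynomials

variable {F : Type*} [Field F] [Finite F]

theorem finite_setOf_monic_natDegree_eq (F : Type*) [Field F] [Finite F] (n : ℕ) :
    {f : F[X] | f.Monic ∧ f.natDegree = n}.Finite := by
  have : Finite {p : F[X] // p.Monic ∧ p.natDegree = n} :=
    Finite.of_equiv (Fin n → F)
      ((monicEquivDegreeLT n).trans (degreeLTEquiv F n).toEquiv).symm
  exact Set.finite_coe_iff.1 this

/-- The monic polynomials of degree `n` over a finite field. -/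
noncomputable def monicsOfDegree (F : Type*) [Field F] [Finite F] (n : ℕ) : Finset F[X] :=
  (finite_setOf_monic_natDegree_eq F n).toFinset

@[simp]
theorem mem_monicsOfDegree {n : ℕ} {f : F[X]} :
    f ∈ monicsOfDegree F n ↔ f.Monic ∧ f.natDegree = n := by
  simp [monicsOfDegree]

theorem finite_setOf_monic_irreducible_natDegree_le (F : Type*) [Field F] [Finite F] (n : ℕ) :
    {f : F[X] | f.Monic ∧ Irreducible f ∧ f.natDegree ≤ n}.Finite := by
  refine Set.Finite.subset ((Finset.range (n + 1)).finite_toSet.biUnion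
    fun k _ => finite_setOf_monic_natDegree_eq F k) ?_
  rintro f ⟨h1, -, h3⟩
  simp only [Set.mem_iUnion]
  exact ⟨f.natDegree, by simpa [Nat.lt_succ_iff] using h3, h1, rfl⟩

/-- The monic irreducible polynomials of degree at most `n` over a finite field. -/
noncomputable def irredsUpTo (F : Type*) [Field F] [Finite F] (n : ℕ) : Finset F[X] :=
  (finite_setOf_monic_irreducible_natDegree_le F n).toFinset

@[simp]
theorem mem_irredsUpTo {n : ℕ} {f : F[X]} :
    f ∈ irredsUpTo F n ↔ f.Monic ∧ Irreducible f ∧ f.natDegree ≤ n := by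
  simp [irredsUpTo]

open Classical in
/-- The degree of a monic polynomial is the total degree of the prime powers dividing it. -/
theorem natDegree_eq_sum_pow_dvd {n : ℕ} {f : F[X]} (hf : f.Monic) (hn : f.natDegree = n) :
    n = ∑ P ∈ irredsUpTo F n, ∑ k ∈ Finset.Icc 1 n, if P ^ k ∣ f then P.natDegree else 0 := by
  set s := UniqueFactorizationMonoid.normalizedFactors f with hs
  have hmon : ∀ P ∈ s, P.Monic ∧ Irreducible P ∧ P.natDegree ≤ n := by
    intro P hP
    refine ⟨?_, UniqueFactorizationMonoid.irreducible_of_normalized_factor P hP, ?_⟩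
    · rw [← UniqueFactorizationMonoid.normalize_normalized_factor P hP]
      exact monic_normalize (UniqueFactorizationMonoid.irreducible_of_normalized_factor P hP).ne_zero
    · exact hn ▸ natDegree_le_of_dvd
        (UniqueFactorizationMonoid.dvd_of_mem_normalizedFactors hP) hf.ne_zero
  have hprod : s.prod = f := by
    rw [UniqueFactorizationMonoid.prod_normalizedFactors_eq hf.ne_zero, hf.normalize_eq_self]
  have hdvd : ∀ P ∈ irredsUpTo F n, ∀ k : ℕ, P ^ k ∣ f ↔ k ≤ s.count P := by
    intro P hP k
    rw [mem_irredsUpTo] at hP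
    have := UniqueFactorizationMonoid.le_emultiplicity_iff_replicate_le_normalizedFactors
      (n := k) hP.2.1 hf.ne_zero
    rw [hP.1.normalize_eq_self, ← pow_dvd_iff_le_emultiplicity,
      ← Multiset.le_count_iff_replicate_le] at this
    exact this
  have hcount : ∀ P ∈ irredsUpTo F n, s.count P ≤ n := by
    intro P hP
    have h1 := (hdvd P hP _).2 le_rfl
    rw [mem_irredsUpTo] at hP
    have h2 := natDegree_le_of_dvd h1 hf.ne_zero
    rw [natDegree_pow, hn] at h2
    exact le_trans (Nat.le_mul_of_pos_right _ hP.2.1.natDegree_pos) h2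
  calc n = (s.map natDegree).sum := by
        rw [← hn, ← hprod, natDegree_multiset_prod_of_monic _ fun P hP => (hmon P hP).1]
    _ = ∑ P ∈ s.toFinset, s.count P * P.natDegree := by
        rw [Finset.sum_multiset_map_count]; simp
    _ = ∑ P ∈ irredsUpTo F n, s.count P * P.natDegree := by
        refine Finset.sum_subset
          (fun P hP => mem_irredsUpTo.2 (hmon P (Multiset.mem_toFinset.1 hP)))
          fun P _ hP => ?_
        rw [Multiset.mem_toFinset] at hP
        rw [Multiset.count_eq_zero_of_notMem hP, zero_mul]
    _ = _ := by
        refine Finset.sum_congr rfl fun P hP => ?_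
        rw [← Finset.sum_filter, Finset.sum_const, smul_eq_mul]
        congr 1
        have : (Finset.Icc 1 n).filter (fun k => P ^ k ∣ f) = Finset.Icc 1 (s.count P) := by
          ext k
          simp only [Finset.mem_filter, Finset.mem_Icc, hdvd P hP]
          have := hcount P hP
          omega
        rw [this]; simp

end MonicPolynomials

/-! ### The logarithmic derivative of an Euler product -/

section EulerProduct

variable {F R : Type*} [Field F] [Finite F] [CommRing R]

/-- The sum of `lam` over the monic polynomials of degree `n`: the `n`-th coefficient of the
generating series `∑ lam(f) U ^ deg f`. -/
noncomputable def monicSum (lam : F[X] → R) (n : ℕ) : R :=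
  ∑ f ∈ monicsOfDegree F n, lam f

open Classical in
/-- The sum of `deg P · lam(P) ^ (n / deg P)` over the monic irreducible `P` with `deg P ∣ n`: the
`n`-th coefficient of the logarithmic derivative of `∏ (1 - lam(P) U ^ deg P)⁻¹`. -/
noncomputable def primePowerSum (lam : F[X] → R) (n : ℕ) : R :=
  ∑ P ∈ irredsUpTo F n,
    if P.natDegree ∣ n then (P.natDegree : R) * lam P ^ (n / P.natDegree) else 0

variable {lam : F[X] → R}

open Classical in
/-- The multiples of `Q` of degree `n` are the products of `Q` with the monic polynomials of degree
`n - deg Q`. -/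
theorem sum_monicsOfDegree_filter_dvd
    (hmul : ∀ f g : F[X], f.Monic → g.Monic → lam (f * g) = lam f * lam g)
    (n : ℕ) {Q : F[X]} (hQ : Q.Monic) :
    (∑ f ∈ (monicsOfDegree F n).filter (fun f => Q ∣ f), lam f) =
      if Q.natDegree ≤ n then lam Q * monicSum lam (n - Q.natDegree) else 0 := by
  split_ifs with h
  · rw [monicSum, Finset.mul_sum]
    symm
    refine Finset.sum_bij (fun g _ => Q * g) ?_ ?_ ?_ ?_
    · intro g hg
      rw [mem_monicsOfDegree] at hg
      simp only [Finset.mem_filter, mem_monicsOfDegree, dvd_mul_right, and_true]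
      exact ⟨hQ.mul hg.1, by rw [hQ.natDegree_mul hg.1, hg.2]; omega⟩
    · intro g _ g' _ hgg
      exact mul_left_cancel₀ hQ.ne_zero hgg
    · intro f hf
      simp only [Finset.mem_filter, mem_monicsOfDegree] at hf
      obtain ⟨⟨hf1, hf2⟩, g, rfl⟩ := hf
      have hg := hQ.of_mul_monic_left hf1
      refine ⟨g, ?_, rfl⟩
      rw [mem_monicsOfDegree]
      rw [hQ.natDegree_mul hg] at hf2
      exact ⟨hg, by omega⟩
    · intro g hg
      rw [mem_monicsOfDegree] at hg
      exact (hmul _ _ hQ hg.1).symm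
  · rw [Finset.filter_false_of_mem, Finset.sum_empty]
    intro f hf hd
    rw [mem_monicsOfDegree] at hf
    exact h (hf.2 ▸ natDegree_le_of_dvd hd hf.1.ne_zero)

open Classical in
/-- The irreducible polynomials of larger degree contribute nothing, so that all prime power sums up
to `n` can be taken over the same index set. -/
theorem primePowerSum_eq_of_le {j n : ℕ} (hj : 1 ≤ j) (hjn : j ≤ n) :
    primePowerSum lam j = ∑ P ∈ irredsUpTo F n,
      if P.natDegree ∣ j then (P.natDegree : R) * lam P ^ (j / P.natDegree) else 0 := by
  refine Finset.sum_subset ?_ ?_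
  · intro P hP
    rw [mem_irredsUpTo] at hP ⊢
    exact ⟨hP.1, hP.2.1, hP.2.2.trans hjn⟩
  · intro P hP hP'
    rw [mem_irredsUpTo] at hP hP'
    rw [if_neg]
    intro hd
    exact hP' ⟨hP.1, hP.2.1, Nat.le_of_dvd hj hd⟩

theorem sum_Icc_ite_mul_le {n d : ℕ} (hd : 1 ≤ d) (φ : ℕ → R) :
    (∑ k ∈ Finset.Icc 1 n, if k * d ≤ n then φ (k * d) else 0) =
      ∑ j ∈ Finset.Icc 1 n, if d ∣ j then φ j else 0 := by
  rw [← Finset.sum_filter, ← Finset.sum_filter]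
  refine Finset.sum_bij (fun k _ => k * d) ?_ ?_ ?_ ?_
  · intro k hk
    simp only [Finset.mem_filter, Finset.mem_Icc, dvd_mul_left, and_true] at hk ⊢
    exact ⟨Nat.mul_pos hk.1.1 hd, hk.2⟩
  · intro k _ k' _ h
    exact Nat.eq_of_mul_eq_mul_right hd h
  · intro j hj
    simp only [Finset.mem_filter, Finset.mem_Icc] at hj
    obtain ⟨⟨h1, h2⟩, k, rfl⟩ := hj
    refine ⟨k, ?_, mul_comm _ _⟩
    simp only [Finset.mem_filter, Finset.mem_Icc]
    refine ⟨⟨Nat.pos_of_mul_pos_left h1, ?_⟩, by rwa [mul_comm]⟩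
    exact le_trans (Nat.le_mul_of_pos_left _ hd) h2
  · intros; rfl

/-- The logarithmic derivative of the Euler product
`∑ lam(f) U ^ deg f = ∏ (1 - lam(P) U ^ deg P)⁻¹`, coefficient by coefficient. -/
theorem natCast_mul_monicSum
    (hone : lam 1 = 1)
    (hmul : ∀ f g : F[X], f.Monic → g.Monic → lam (f * g) = lam f * lam g) (n : ℕ) :
    (n : R) * monicSum lam n =
      ∑ j ∈ Finset.Icc 1 n, primePowerSum lam j * monicSum lam (n - j) := by
  classical
  have hpow : ∀ (P : F[X]), P.Monic → ∀ k : ℕ, lam (P ^ k) = lam P ^ k := by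
    intro P hP k
    induction k with
    | zero => simpa using hone
    | succ k ih => rw [pow_succ, pow_succ, hmul _ _ (hP.pow k) hP, ih]
  -- Write `n = deg f` as a sum over the prime powers dividing `f`.
  have h1 : (n : R) * monicSum lam n = ∑ P ∈ irredsUpTo F n, ∑ k ∈ Finset.Icc 1 n,
      (P.natDegree : R) * ∑ f ∈ (monicsOfDegree F n).filter (fun f => P ^ k ∣ f), lam f := by
    rw [monicSum, Finset.mul_sum]
    have : ∀ f ∈ monicsOfDegree F n, (n : R) * lam f = ∑ P ∈ irredsUpTo F n,
        ∑ k ∈ Finset.Icc 1 n, if P ^ k ∣ f then (P.natDegree : R) * lam f else 0 := by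
      intro f hf
      rw [mem_monicsOfDegree] at hf
      conv_lhs => rw [natDegree_eq_sum_pow_dvd hf.1 hf.2]
      push_cast
      simp only [Finset.sum_mul, ite_mul, zero_mul]
    rw [Finset.sum_congr rfl this, Finset.sum_comm]
    refine Finset.sum_congr rfl fun P _ => ?_
    rw [Finset.sum_comm]
    refine Finset.sum_congr rfl fun k _ => ?_
    rw [Finset.mul_sum, Finset.sum_filter]
  rw [h1]
  have h2 : ∑ j ∈ Finset.Icc 1 n, primePowerSum lam j * monicSum lam (n - j) =
      ∑ P ∈ irredsUpTo F n, ∑ j ∈ Finset.Icc 1 n, if P.natDegree ∣ j then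
        (P.natDegree : R) * (lam P ^ (j / P.natDegree) * monicSum lam (n - j)) else 0 := by
    rw [Finset.sum_comm]
    refine Finset.sum_congr rfl fun j hj => ?_
    rw [Finset.mem_Icc] at hj
    rw [primePowerSum_eq_of_le hj.1 hj.2, Finset.sum_mul]
    simp only [ite_mul, zero_mul, mul_assoc]
  rw [h2]
  refine Finset.sum_congr rfl fun P hP => ?_
  rw [mem_irredsUpTo] at hP
  have hd : 1 ≤ P.natDegree := hP.2.1.natDegree_pos
  rw [← sum_Icc_ite_mul_le hd fun j =>
    (P.natDegree : R) * (lam P ^ (j / P.natDegree) * monicSum lam (n - j))]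
  refine Finset.sum_congr rfl fun k _ => ?_
  rw [sum_monicsOfDegree_filter_dvd hmul n (hP.1.pow k), hP.1.natDegree_pow, hpow P hP.1,
    mul_ite, mul_zero, Nat.mul_div_cancel _ hd]

/-- If the generating series `∑ monicSum lam n U ^ n` is the polynomial `1 + G U`, then the
prime power sums are, up to sign, the powers of `G`. -/
theorem primePowerSum_eq_pow
    (hone : lam 1 = 1)
    (hmul : ∀ f g : F[X], f.Monic → g.Monic → lam (f * g) = lam f * lam g)
    (hzero : ∀ n, 2 ≤ n → monicSum lam n = 0) (n : ℕ) :
    primePowerSum lam (n + 1) = (-1) ^ n * monicSum lam 1 ^ (n + 1) := by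
  have h0 : monicSum lam 0 = 1 := by
    have : monicsOfDegree F 0 = {1} := by
      ext f
      rw [mem_monicsOfDegree, Finset.mem_singleton]
      exact ⟨fun h => h.1.natDegree_eq_zero.1 h.2, fun h => by simp [h]⟩
    rw [monicSum, this, Finset.sum_singleton, hone]
  induction n with
  | zero =>
    have := natCast_mul_monicSum hone hmul 1
    simp [h0] at this
    simp [this]
  | succ n ih =>
    have := natCast_mul_monicSum hone hmul (n + 2)
    rw [hzero _ (by omega), mul_zero, Finset.sum_Icc_succ_top (by omega),
      Finset.sum_Icc_succ_top (by omega), Finset.sum_eq_zero] at this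
    · rw [show n + 2 - (n + 1) = 1 by omega, show n + 2 - (n + 1 + 1) = 0 by omega, h0, ih] at this
      have h3 : primePowerSum lam (n + 1 + 1) =
        - ((-1) ^ n * monicSum lam 1 ^ (n + 1) * monicSum lam 1) := by
        linear_combination -this
      rw [h3]; ring
    · intro j hj
      rw [Finset.mem_Icc] at hj
      rw [hzero _ (by omega), mul_zero]

end EulerProduct

/-! ### Elements of a finite extension and their minimal polynomials -/

section Fibres

variable {F E : Type*} [Field F] [Finite F] [Field E] [Finite E] [Algebra F E]

open Classical in
/-- Over a finite field, an irreducible polynomial whose degree divides the degree of an extension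
splits there into distinct linear factors; otherwise it has no root there. -/
theorem ncard_minpoly_eq {P : F[X]} (hP : P.Monic) (hP' : Irreducible P) :
    {x : E | minpoly F x = P}.ncard =
      if P.natDegree ∣ Module.finrank F E then P.natDegree else 0 := by
  have : Module.Finite F E := Module.Finite.of_finite
  split_ifs with h
  · have hset : {x : E | minpoly F x = P} = P.rootSet E := by
      ext x
      rw [Set.mem_ofPred_eq, mem_rootSet]
      constructor
      · rintro rfl
        exact ⟨hP.ne_zero, minpoly.aeval F x⟩
      · rintro ⟨-, h⟩
        exact (minpoly.eq_of_irreducible_of_monic hP' h hP).symm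
    rw [hset, ← Nat.card_coe_set_eq, Nat.card_eq_fintype_card]
    refine card_rootSet_eq_natDegree (PerfectField.separable_of_irreducible hP') ?_
    have h1 := map_dvd (mapRingHom (algebraMap F E))
      (hP'.natDegree_dvd_iff_dvd_X_pow_card_pow_sub_X.1 h)
    have hE : Nat.card F ^ Module.finrank F E = Nat.card E :=
      (Module.natCard_eq_pow_finrank (K := F) (V := E)).symm
    rw [hE] at h1
    refine Splits.of_dvd ?_ ?_ h1
    · simpa using Polynomial.splits_X_pow_nat_card_sub_X (K := E)
    · rw [coe_mapRingHom]
      exact map_ne_zero (FiniteField.X_pow_card_sub_X_ne_zero _ Finite.one_lt_card)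
  · rw [Set.ncard_eq_zero]
    ext x
    simp only [Set.mem_ofPred_eq, Set.mem_empty_iff_false, iff_false]
    rintro rfl
    exact h (minpoly.degree_dvd (.of_finite F x))

open Classical in
/-- Grouping the elements of a finite extension by their minimal polynomials. -/
theorem sum_comp_minpoly {R : Type*} [CommRing R] [Fintype E] (φ : F[X] → R) :
    ∑ x : E, φ (minpoly F x) = ∑ P ∈ irredsUpTo F (Module.finrank F E),
      if P.natDegree ∣ Module.finrank F E then (P.natDegree : R) * φ P else 0 := by
  have : Module.Finite F E := Module.Finite.of_finite
  rw [← Finset.sum_fiberwise_of_maps_to (t := irredsUpTo F (Module.finrank F E))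
    (g := fun x : E => minpoly F x)]
  · refine Finset.sum_congr rfl fun P hP => ?_
    rw [mem_irredsUpTo] at hP
    have h1 : ∑ x with minpoly F x = P, φ (minpoly F x) = ∑ x : E with minpoly F x = P, φ P :=
      Finset.sum_congr rfl fun x hx => by rw [(Finset.mem_filter.1 hx).2]
    have h2 : (Finset.univ.filter fun x : E => minpoly F x = P).card =
        if P.natDegree ∣ Module.finrank F E then P.natDegree else 0 := by
      rw [← ncard_minpoly_eq hP.1 hP.2.1, ← Set.ncard_coe_finset]
      simp
    rw [h1, Finset.sum_const, h2, nsmul_eq_mul]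
    split_ifs <;> simp
  · intro x _
    rw [mem_irredsUpTo]
    exact ⟨minpoly.monic (.of_finite F x), minpoly.irreducible (.of_finite F x),
      minpoly.natDegree_le x⟩

end Fibres

section CharacteristicPolynomial

open IntermediateField

variable {F E : Type*} [Field F] [Field E] [Algebra F E] [FiniteDimensional F E]

theorem trace_eq_mul_nextCoeff_minpoly (x : E) :
    Algebra.trace F E x =
      (Module.finrank F E / (minpoly F x).natDegree : ℕ) * -(minpoly F x).nextCoeff := by
  rw [trace_eq_finrank_mul_minpoly_nextCoeff]
  congr 2
  rw [← adjoin.finrank (.of_finite F x), ← Module.finrank_mul_finrank F F⟮x⟯ E,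
    Nat.mul_div_cancel_left _ Module.finrank_pos]

theorem norm_eq_coeff_zero_minpoly_pow (x : E) :
    Algebra.norm F x = ((-1) ^ (minpoly F x).natDegree * (minpoly F x).coeff 0) ^
      (Module.finrank F E / (minpoly F x).natDegree) := by
  have hx : IsIntegral F x := .of_finite F x
  have h := Algebra.PowerBasis.norm_gen_eq_coeff_zero_minpoly (adjoin.powerBasis hx)
  rw [adjoin.powerBasis_gen, adjoin.powerBasis_dim, minpoly_gen] at h
  rw [Algebra.norm_eq_norm_adjoin, h]
  congr 1
  rw [← adjoin.finrank hx, ← Module.finrank_mul_finrank F F⟮x⟯ E,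
    Nat.mul_div_cancel_left _ Module.finrank_pos]

end CharacteristicPolynomial

/-! ### The Hasse–Davenport relation -/

section HasseDavenport

variable {F R : Type*} [Field F] [CommRing R]

/-- The completely multiplicative function `f ↦ χ(N f) ψ(Tr f)` on monic polynomials, where
`N f` and `Tr f` are the product and the sum of the roots of `f`. -/
noncomputable def polyChar (χ : MulChar F R) (ψ : AddChar F R) (f : F[X]) : R :=
  χ ((-1) ^ f.natDegree * f.coeff 0) * ψ (-f.nextCoeff)

variable (χ : MulChar F R) (ψ : AddChar F R)

theorem polyChar_one : polyChar χ ψ 1 = 1 := by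
  rw [polyChar, ← C_1, nextCoeff_C_eq_zero]
  simp

theorem polyChar_mul {f g : F[X]} (hf : f.Monic) (hg : g.Monic) :
    polyChar χ ψ (f * g) = polyChar χ ψ f * polyChar χ ψ g := by
  rw [polyChar, hf.natDegree_mul hg, mul_coeff_zero, hf.nextCoeff_mul hg, neg_add,
    AddChar.map_add_eq_mul, pow_add, mul_mul_mul_comm, map_mul, polyChar, polyChar]
  ring

variable [Fintype F]

theorem monicSum_polyChar_one : monicSum (polyChar χ ψ) 1 = gaussSum χ ψ := by
  rw [monicSum, gaussSum]
  symm
  refine Finset.sum_bij (fun c _ => X - C c) ?_ ?_ ?_ ?_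
  · intro c _
    rw [mem_monicsOfDegree]
    exact ⟨monic_X_sub_C c, natDegree_X_sub_C c⟩
  · intro c _ c' _ h
    exact C_injective (sub_right_injective h)
  · intro f hf
    rw [mem_monicsOfDegree] at hf
    refine ⟨-f.coeff 0, Finset.mem_univ _, ?_⟩
    rw [map_neg, sub_neg_eq_add]
    exact (hf.1.eq_X_add_C hf.2).symm
  · intro c _
    simp [polyChar, nextCoeff]

/-- Translating the second coefficient shows that the sums over polynomials of a fixed degree
`≥ 2` vanish. -/
theorem monicSum_polyChar_eq_zero [IsDomain R] (hψ : ψ ≠ 1) {n : ℕ} (hn : 2 ≤ n) :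
    monicSum (polyChar χ ψ) n = 0 := by
  obtain ⟨y, hy⟩ := AddChar.ne_one_iff.1 hψ
  have hdeg : ∀ {f : F[X]} (c : F), f ∈ monicsOfDegree F n →
      f + C c * X ^ (n - 1) ∈ monicsOfDegree F n := by
    intro f c hf
    rw [mem_monicsOfDegree] at hf ⊢
    have hlt : (C c * X ^ (n - 1)).degree < f.degree := by
      refine (degree_C_mul_X_pow_le _ _).trans_lt ?_
      rw [degree_eq_natDegree hf.1.ne_zero, hf.2]
      exact_mod_cast (by omega : n - 1 < n)
    exact ⟨hf.1.add_of_left hlt, by rw [natDegree_add_eq_left_of_degree_lt hlt, hf.2]⟩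
  have hval : ∀ {f : F[X]} (c : F), f ∈ monicsOfDegree F n →
      polyChar χ ψ (f + C c * X ^ (n - 1)) = ψ (-c) * polyChar χ ψ f := by
    intro f c hf
    have h1 := mem_monicsOfDegree.1 (hdeg c hf)
    rw [mem_monicsOfDegree] at hf
    rw [polyChar, polyChar, h1.2, nextCoeff_of_natDegree_pos (by omega),
      nextCoeff_of_natDegree_pos (by omega), h1.2, hf.2]
    rw [coeff_add, coeff_add, coeff_C_mul_X_pow, coeff_C_mul_X_pow, if_neg (by omega), if_pos rfl,
      add_zero, neg_add, AddChar.map_add_eq_mul]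
    ring
  -- Translate by `-y X ^ (n - 1)`; as `n - 1 ≠ 0`, the constant coefficient does not change.
  have key : monicSum (polyChar χ ψ) n = ψ y * monicSum (polyChar χ ψ) n := by
    conv_rhs => rw [monicSum, Finset.mul_sum]
    rw [monicSum]
    symm
    refine Finset.sum_bij (fun f _ => f + C (-y) * X ^ (n - 1)) (fun f hf => hdeg _ hf)
      (fun f _ g _ h => add_right_cancel h) (fun f hf => ⟨_, hdeg y hf, ?_⟩) (fun f hf => ?_)
    · simp
    · rw [hval _ hf, neg_neg]
  have : (ψ y - 1) * monicSum (polyChar χ ψ) n = 0 := by linear_combination -key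
  exact (mul_eq_zero.1 this).resolve_left (sub_ne_zero.2 hy)

/-- The Hasse–Davenport relation: lifting both characters of a Gauss sum along an extension of
degree `t` replaces the negative of the Gauss sum by its `t`-th power. -/
theorem sum_char_norm_mul_char_trace [IsDomain R] (hψ : ψ ≠ 1) {E : Type*} [Field E] [Fintype E]
    [Algebra F E] :
    ∑ x : E, χ (Algebra.norm F x) * ψ (Algebra.trace F E x) =
      (-1) ^ (Module.finrank F E - 1) * gaussSum χ ψ ^ Module.finrank F E := by
  have : Module.Finite F E := Module.Finite.of_finite
  have hpos : 0 < Module.finrank F E := Module.finrank_pos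
  have h := primePowerSum_eq_pow (polyChar_one χ ψ) (fun f g => polyChar_mul χ ψ)
    (fun n => monicSum_polyChar_eq_zero χ ψ hψ) (Module.finrank F E - 1)
  rw [Nat.sub_add_cancel hpos, monicSum_polyChar_one] at h
  rw [← h, primePowerSum, ← sum_comp_minpoly fun P =>
    polyChar χ ψ P ^ (Module.finrank F E / P.natDegree)]
  refine Finset.sum_congr rfl fun x _ => ?_
  rw [norm_eq_coeff_zero_minpoly_pow, trace_eq_mul_nextCoeff_minpoly, map_pow, ← nsmul_eq_mul,
    AddChar.map_nsmul_eq_pow, polyChar, mul_pow]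

end HasseDavenport

/-! ### Character sums over the elements of given trace -/

section TraceFibres

variable {F : Type*} [Field F]

open Classical in
/-- The sum of `θ(N x)` over the elements `x` of the extension `E / F` with trace `b`. -/
noncomputable def traceFibreSum (E : Type*) [Field E] [Fintype E] [Algebra F E]
    (θ : MulChar F ℂ) (b : F) : ℂ :=
  ∑ x : E with Algebra.trace F E x = b, θ (Algebra.norm F x)

variable {E : Type*} [Field E] [Fintype E] [Algebra F E]

/-- A nontrivial character composed with the (surjective) norm has sum zero. -/
theorem sum_char_norm_eq_zero {θ : MulChar F ℂ} (hθ : θ ≠ 1) :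
    ∑ x : E, θ (Algebra.norm F x) = 0 := by
  have : Module.Finite F E := Module.Finite.of_finite
  obtain ⟨c, hc⟩ := MulChar.ne_one_iff.1 hθ
  obtain ⟨y, hy⟩ := FiniteField.unitsMap_norm_surjective F E c
  have hy' : Algebra.norm F (y : E) = c := by rw [← hy]; rfl
  have h : ∑ x : E, θ (Algebra.norm F x) = θ c * ∑ x : E, θ (Algebra.norm F x) := by
    rw [Finset.mul_sum]
    refine (Fintype.sum_equiv y.mulLeft _ _ fun x => ?_).symm
    rw [Units.mulLeft_apply, map_mul, map_mul, hy']
  have h2 : (θ c - 1) * ∑ x : E, θ (Algebra.norm F x) = 0 := by linear_combination -h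
  exact (mul_eq_zero.1 h2).resolve_left (sub_ne_zero.2 hc)

variable [Fintype F]

theorem sum_one_norm :
    ∑ x : E, (1 : MulChar F ℂ) (Algebra.norm F x) =
      (Fintype.card F : ℂ) ^ Module.finrank F E - 1 := by
  classical
  have : Module.Finite F E := Module.Finite.of_finite
  have h : ∀ x : E, (1 : MulChar F ℂ) (Algebra.norm F x) = 1 - if x = 0 then 1 else 0 := by
    intro x
    by_cases hx : x = 0
    · rw [hx, Algebra.norm_zero, MulChar.map_zero, if_pos rfl, sub_self]
    · rw [MulChar.one_apply (isUnit_iff_ne_zero.2 (Algebra.norm_ne_zero_iff.2 hx)), if_neg hx,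
        sub_zero]
  rw [Finset.sum_congr rfl fun x _ => h x, Finset.sum_sub_distrib, Finset.sum_ite_eq',
    if_pos (Finset.mem_univ _), Finset.sum_const, Finset.card_univ,
    Module.card_eq_pow_finrank (K := F) (V := E)]
  simp

/-- Detecting the trace by additive characters, and evaluating the resulting sums over `E` by the
Hasse–Davenport relation. -/
theorem card_mul_traceFibreSum (θ : MulChar F ℂ) {ψ : AddChar F ℂ} (hψ : ψ.IsPrimitive) (b : F) :
    (Fintype.card F : ℂ) * traceFibreSum E θ b =
      ∑ x : E, θ (Algebra.norm F x) +
        (-1) ^ (Module.finrank F E - 1) * gaussSum θ ψ ^ Module.finrank F E *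
          gaussSum (θ ^ Module.finrank F E)⁻¹ (ψ.mulShift (-b)) := by
  classical
  have : Module.Finite F E := Module.Finite.of_finite
  have hpos : Module.finrank F E ≠ 0 := Module.finrank_pos.ne'
  have h1 : (Fintype.card F : ℂ) * traceFibreSum E θ b =
      ∑ u : F, ψ (u * -b) * ∑ x : E, θ (Algebra.norm F x) * ψ (u * Algebra.trace F E x) := by
    simp only [Finset.mul_sum]
    rw [Finset.sum_comm, traceFibreSum, Finset.mul_sum, Finset.sum_filter]
    refine Finset.sum_congr rfl fun x _ => ?_
    have h2 : ∀ u : F, ψ (u * -b) * (θ (Algebra.norm F x) * ψ (u * Algebra.trace F E x)) =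
        θ (Algebra.norm F x) * ψ (u * (Algebra.trace F E x - b)) := by
      intro u
      rw [sub_eq_add_neg, mul_add, AddChar.map_add_eq_mul]
      ring
    simp only [h2]
    rw [← Finset.mul_sum, AddChar.sum_mulShift _ hψ]
    simp only [sub_eq_zero]
    split_ifs <;> simp [mul_comm]
  -- The term `u = 0` is the first summand; at `u ≠ 0` the inner sum is a lifted Gauss sum.
  rw [h1, ← Finset.add_sum_erase _ _ (Finset.mem_univ (0 : F))]
  congr 1
  · simp
  · rw [gaussSum.eq_1 (θ ^ _)⁻¹, Finset.mul_sum,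
      ← Finset.add_sum_erase _ _ (Finset.mem_univ (0 : F)),
      MulChar.map_zero, zero_mul, mul_zero, zero_add]
    refine Finset.sum_congr rfl fun u hu => ?_
    have hu0 : u ≠ 0 := (Finset.mem_erase.1 hu).1
    have h3 := sum_char_norm_mul_char_trace θ (ψ.mulShift u) (hψ hu0) (E := E)
    simp only [AddChar.mulShift_apply] at h3
    have h4 := gaussSum_mulShift_eq θ ψ (Units.mk0 u hu0)
    rw [Units.val_mk0] at h4
    rw [h3, h4, AddChar.mulShift_apply, mul_pow, ← inv_pow, MulChar.pow_apply' _ hpos,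
      mul_comm u]
    ring

open Classical in
/-- The trivial character is `0` at `0`, so that for `b = 0` the element `0` is not counted. -/
theorem traceFibreSum_one (b : F) :
    traceFibreSum E 1 b =
      (Fintype.card F : ℂ) ^ (Module.finrank F E - 1) - if b = 0 then 1 else 0 := by
  have : Module.Finite F E := Module.Finite.of_finite
  have hpos : 0 < Module.finrank F E := Module.finrank_pos
  have hq : (Fintype.card F : ℂ) ≠ 0 := by exact_mod_cast Fintype.card_ne_zero
  have hψ := AddChar.FiniteField.primitiveChar_to_Complex_isPrimitive F
  set ψ := AddChar.FiniteField.primitiveChar_to_Complex F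
  have hψ1 : ψ ≠ 1 := by simpa using hψ one_ne_zero
  have h := card_mul_traceFibreSum (E := E) 1 hψ b
  rw [sum_one_norm, gaussSum_one_left hψ1, one_pow, inv_one] at h
  obtain ⟨k, hk⟩ : ∃ k, Module.finrank F E = k + 1 := ⟨_, (Nat.sub_add_cancel hpos).symm⟩
  rw [hk, Nat.add_sub_cancel] at h ⊢
  have hsgn : (-1 : ℂ) ^ k * (-1) ^ (k + 1) = -1 := by
    rw [← pow_add]; exact Odd.neg_one_pow ⟨k, by ring⟩
  apply mul_left_cancel₀ hq
  rw [h, hsgn]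
  split_ifs with hb
  · rw [hb, neg_zero, AddChar.mulShift_zero, gaussSum_one_one, Nat.card_eq_fintype_card,
      Fintype.card_units, Nat.cast_sub Fintype.card_pos]
    push_cast; ring
  · rw [gaussSum_one_left (hψ (neg_ne_zero.2 hb))]; ring

open Classical in
theorem traceFibreSum_zero {θ : MulChar F ℂ} (hθ : θ ≠ 1) {ψ : AddChar F ℂ} (hψ : ψ.IsPrimitive) :
    (Fintype.card F : ℂ) * traceFibreSum E θ 0 =
      (-1) ^ (Module.finrank F E - 1) * gaussSum θ ψ ^ Module.finrank F E *
        if θ ^ Module.finrank F E = 1 then (Fintype.card F : ℂ) - 1 else 0 := by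
  rw [card_mul_traceFibreSum θ hψ, sum_char_norm_eq_zero hθ, zero_add, neg_zero,
    AddChar.mulShift_zero]
  split_ifs with h
  · rw [h, inv_one, gaussSum_one_one, Nat.card_eq_fintype_card,
      Fintype.card_units, Nat.cast_sub Fintype.card_pos, Nat.cast_one]
  · rw [gaussSum_one_right (inv_ne_one.2 h)]

theorem traceFibreSum_of_ne_zero {θ : MulChar F ℂ} (hθ : θ ≠ 1) {ψ : AddChar F ℂ}
    (hψ : ψ.IsPrimitive) {b : F} (hb : b ≠ 0) :
    (Fintype.card F : ℂ) * traceFibreSum E θ b =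
      (-1) ^ (Module.finrank F E - 1) * gaussSum θ ψ ^ Module.finrank F E *
        ((θ ^ Module.finrank F E) (-b) * gaussSum (θ ^ Module.finrank F E)⁻¹ ψ) := by
  rw [card_mul_traceFibreSum θ hψ, sum_char_norm_eq_zero hθ, zero_add]
  have h4 := gaussSum_mulShift_eq (θ ^ Module.finrank F E)⁻¹ ψ (Units.mk0 (-b) (neg_ne_zero.2 hb))
  rw [Units.val_mk0] at h4
  rw [h4, inv_inv]

theorem conj_traceFibreSum (θ : MulChar F ℂ) (b : F) :
    conj (traceFibreSum E θ b) = traceFibreSum E θ⁻¹ b := by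
  rw [traceFibreSum, traceFibreSum, map_sum]
  refine Finset.sum_congr rfl fun x _ => ?_
  simpa using MulChar.star_apply' θ (Algebra.norm F x)

end TraceFibres

/-! ### The quartic character and the cosets of the fourth powers -/

section QuarticCharacter

variable {F : Type*} [Field F]

theorem I_pow_eq_I_pow_iff {a b : ℕ} : I ^ a = I ^ b ↔ a ≡ b [MOD 4] := by
  have h4 : ∀ n : ℕ, I ^ n = I ^ (n % 4) := fun n => by
    conv_lhs => rw [← Nat.div_add_mod n 4, pow_add, pow_mul, I_pow_four, one_pow, one_mul]
  rw [h4 a, h4 b, Nat.ModEq]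
  have ha : a % 4 < 4 := Nat.mod_lt _ (by norm_num)
  have hb : b % 4 < 4 := Nat.mod_lt _ (by norm_num)
  generalize a % 4 = x at *
  generalize b % 4 = y at *
  interval_cases x <;> interval_cases y <;> simp [pow_succ, Complex.ext_iff] <;> norm_num

variable {g : Fˣ} {χ : MulChar F ℂ}

theorem exists_eq_pow [Finite F] (hg : ∀ x : Fˣ, x ∈ Subgroup.zpowers g) {y : F} (hy : y ≠ 0) :
    ∃ k : ℕ, y = (g : F) ^ k := by
  obtain ⟨k, hk⟩ := mem_powers_iff_mem_zpowers.2 (hg (Units.mk0 y hy))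
  exact ⟨k, by simpa using congrArg (Units.val) hk.symm⟩

/-- Membership in a coset of the fourth powers is detected by the quartic character. -/
theorem mem_powCoset_four_iff [Finite F] (hg : ∀ x : Fˣ, x ∈ Subgroup.zpowers g)
    (hχ : χ (g : F) = I) {h : ℕ} {y : F} : y ∈ powCoset g 4 h ↔ χ y = I ^ h := by
  constructor
  · rintro ⟨j, rfl⟩
    have h4 : χ ((g ^ 4 : Fˣ) : F) = 1 := by simp [hχ]
    have h5 : χ (((g ^ 4) ^ j : Fˣ) : F) = 1 := by
      have := congrArg Units.val (map_zpow (MulChar.toUnitHom χ) (g ^ 4) j)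
      rw [MulChar.coe_toUnitHom] at this
      rw [this]
      have h6 : MulChar.toUnitHom χ (g ^ 4) = 1 := by
        ext; rw [MulChar.coe_toUnitHom, h4]; rfl
      rw [h6]; simp
    rw [Units.val_mul, map_mul, h5, mul_one, Units.val_pow_eq_pow_val, map_pow, hχ]
  · intro hy
    have hy0 : y ≠ 0 := by
      rintro rfl
      rw [MulChar.map_zero] at hy
      exact pow_ne_zero h I_ne_zero hy.symm
    obtain ⟨k, rfl⟩ := exists_eq_pow hg hy0
    rw [map_pow, hχ, I_pow_eq_I_pow_iff] at hy
    obtain ⟨j, hj⟩ := (Nat.modEq_iff_dvd.1 hy.symm)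
    refine ⟨j, ?_⟩
    have : (g : Fˣ) ^ k = g ^ h * (g ^ 4) ^ j := by
      rw [← zpow_natCast, ← zpow_natCast, ← zpow_natCast, ← zpow_mul, ← zpow_add]
      congr 1
      push_cast at hj ⊢
      linarith
    rw [← this]; simp

theorem pow_four_eq_one [Finite F] (hg : ∀ x : Fˣ, x ∈ Subgroup.zpowers g)
    (hχ : χ (g : F) = I) : χ ^ 4 = 1 := by
  ext x
  obtain ⟨k, hk⟩ := exists_eq_pow hg x.ne_zero
  rw [MulChar.pow_apply_coe, hk, map_pow, hχ, ← hk, MulChar.one_apply_coe, ← pow_mul, mul_comm,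
    pow_mul, I_pow_four, one_pow]

/-- Orthogonality of the powers of `χ`, with `I ^ (3 * h * j)` in place of `I ^ (-h * j)`. -/
theorem sum_pow_mul_I_pow [Finite F] (hg : ∀ x : Fˣ, x ∈ Subgroup.zpowers g)
    (hχ : χ (g : F) = I) (h : ℕ) (y : F) :
    ∑ j ∈ Finset.range 4, I ^ (3 * h * j) * (χ ^ j) y = if χ y = I ^ h then 4 else 0 := by
  by_cases hy0 : y = 0
  · subst hy0
    rw [if_neg]
    · exact Finset.sum_eq_zero fun j _ => by rw [MulChar.map_zero, mul_zero]
    · rw [MulChar.map_zero]; exact (pow_ne_zero h I_ne_zero).symm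
  obtain ⟨k, hk⟩ := exists_eq_pow hg hy0
  have hyI : χ y = I ^ k := by rw [hk, map_pow, hχ]
  have hj : ∀ j, (χ ^ j) y = (χ y) ^ j := fun j => by
    have := MulChar.pow_apply_coe χ j (Units.mk0 y hy0)
    simpa using this
  simp only [hj, hyI, ← pow_mul, ← pow_add, I_pow_eq_I_pow_iff]
  have h1 : ∀ j, I ^ (3 * h * j + k * j) = (I ^ (3 * h + k)) ^ j := fun j => by
    rw [← pow_mul]; ring_nf
  simp only [h1]
  have h2 : I ^ (3 * h + k) = I ^ ((3 * h + k) % 4) := by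
    rw [I_pow_eq_I_pow_iff]; exact (Nat.mod_modEq _ _).symm
  rw [h2]
  have h3 : (3 * h + k) % 4 < 4 := Nat.mod_lt _ (by norm_num)
  have h4 : k ≡ h [MOD 4] ↔ (3 * h + k) % 4 = 0 := by
    unfold Nat.ModEq; omega
  simp only [h4]
  generalize (3 * h + k) % 4 = r at *
  interval_cases r <;> simp [Finset.sum_range_succ, pow_succ]

end QuarticCharacter

/-! ### The quartic Jacobi sum -/

section QuarticValues

variable {F : Type*} [Field F] [Fintype F] {g : Fˣ} {χ : MulChar F ℂ}

open Classical in
/-- A function which, like `χ`, is `0` at `0` and multiplicative of order dividing `4`, is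
summed by counting the values of `χ`. -/
theorem sum_comp_eq_sum_card_mul_pow (hg : ∀ x : Fˣ, x ∈ Subgroup.zpowers g)
    (hχ : χ (g : F) = I) {R : Type*} [CommRing R] {φ : F → R} {Z : R} (hZ : Z ^ 4 = 1)
    (h0 : φ 0 = 0) (hφ : ∀ k : ℕ, φ ((g : F) ^ k) = Z ^ k) (u : F → F) :
    ∑ x, φ (u x) = ∑ c ∈ Finset.range 4,
      ((Finset.univ.filter fun x => χ (u x) = I ^ c).card : R) * Z ^ c := by
  have key : ∀ y : F, φ y = ∑ c ∈ Finset.range 4, if χ y = I ^ c then Z ^ c else 0 := by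
    intro y
    by_cases hy : y = 0
    · subst hy
      rw [h0, Finset.sum_eq_zero]
      intro c _
      rw [if_neg]
      rw [MulChar.map_zero]
      exact (pow_ne_zero c I_ne_zero).symm
    · obtain ⟨k, rfl⟩ := exists_eq_pow hg hy
      rw [hφ, map_pow, hχ]
      simp only [I_pow_eq_I_pow_iff]
      have h1 : Z ^ k = Z ^ (k % 4) := by
        conv_lhs => rw [← Nat.div_add_mod k 4, pow_add, pow_mul, hZ, one_pow, one_mul]
      rw [Finset.sum_eq_single (k % 4), if_pos (Nat.mod_modEq k 4).symm, h1]
      · intro c hc hck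
        rw [if_neg]
        intro h
        rw [Nat.ModEq, Nat.mod_eq_of_lt (Finset.mem_range.1 hc)] at h
        exact hck h.symm
      · intro h
        exact absurd (Finset.mem_range.2 (Nat.mod_lt _ (by norm_num))) h
  simp only [key]
  rw [Finset.sum_comm]
  refine Finset.sum_congr rfl fun c _ => ?_
  rw [← Finset.sum_filter, Finset.sum_const, nsmul_eq_mul]

/-- The element `g ^ f`, of order `4`, is a square root of `-1`. -/
theorem pow_card_sub_one_div_two (hg : ∀ x : Fˣ, x ∈ Subgroup.zpowers g)
    {f : ℕ} (hf : Fintype.card F = 4 * f + 1) :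
    ((g : F) ^ f) ^ 2 = -1 := by
  classical
  have hord : orderOf g = 4 * f := by
    rw [orderOf_eq_card_of_forall_mem_zpowers hg, Nat.card_eq_fintype_card, Fintype.card_units, hf]
    rfl
  have hf0 : 0 < f := by
    have := Fintype.one_lt_card (α := F)
    omega
  have h4 : (((g : F) ^ f) ^ 2) ^ 2 = 1 := by
    rw [← pow_mul, ← pow_mul, show f * (2 * 2) = orderOf g by rw [hord]; ring,
      ← Units.val_pow_eq_pow_val, pow_orderOf_eq_one, Units.val_one]
  rcases sq_eq_sq_iff_eq_or_eq_neg.1 (h4.trans (one_pow 2).symm) with h | h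
  · exfalso
    rw [← pow_mul, ← Units.val_pow_eq_pow_val, Units.val_eq_one] at h
    have := Nat.le_of_dvd (by omega) (orderOf_dvd_of_pow_eq_one h)
    omega
  · exact h

theorem char_neg_one (hg : ∀ x : Fˣ, x ∈ Subgroup.zpowers g) (hχ : χ (g : F) = I)
    {f : ℕ} (hf : Fintype.card F = 4 * f + 1) : χ (-1) = (-1) ^ f := by
  rw [← pow_card_sub_one_div_two hg hf, ← pow_mul, map_pow, hχ, mul_comm, pow_mul, I_sq]

/-- The summand is a polynomial in `x` of degree `2 * f < #F - 1`. -/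
theorem sum_pow_mul_one_sub_pow {f : ℕ} (hf : Fintype.card F = 4 * f + 1) :
    ∑ x : F, (x * (1 - x)) ^ f = 0 := by
  have hf0 : 0 < f := by
    have := Fintype.one_lt_card (α := F)
    omega
  have h : ∀ x : F, (x * (1 - x)) ^ f =
      ∑ i ∈ Finset.range (f + 1), (-1) ^ i * (f.choose i : F) * x ^ (f + i) := by
    intro x
    rw [mul_pow, sub_eq_neg_add, add_pow, Finset.mul_sum]
    refine Finset.sum_congr rfl fun i _ => ?_
    rw [neg_pow, pow_add]; ring
  simp only [h]
  rw [Finset.sum_comm]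
  refine Finset.sum_eq_zero fun i hi => ?_
  rw [← Finset.mul_sum, FiniteField.sum_pow_lt_card_sub_one, mul_zero]
  have := Finset.mem_range.1 hi
  omega

end QuarticValues

section JacobiSum

variable {p : ℕ} [Fact p.Prime] {g : (ZMod p)ˣ} {χ : MulChar (ZMod p) ℂ}

theorem quarticChar_pow_ne_one (hχ : χ (g : ZMod p) = I) : χ ≠ 1 ∧ χ ^ 2 ≠ 1 ∧ χ ^ 3 ≠ 1 := by
  have h : ∀ j, χ ^ j = 1 → I ^ j = 1 := by
    intro j hj
    rw [← hχ, ← MulChar.pow_apply_coe, hj, MulChar.one_apply_coe]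
  refine ⟨fun h1 => ?_, fun h1 => ?_, fun h1 => ?_⟩
  · have := h 1 (by simpa using h1)
    simp [Complex.ext_iff] at this
  · have := h 2 h1
    rw [I_sq] at this; norm_num at this
  · have := h 3 h1
    simp [pow_succ, Complex.ext_iff] at this

theorem two_ne_zero_of_ne_two (hp2 : p ≠ 2) : (2 : ZMod p) ≠ 0 := by
  have : ((2 : ℕ) : ZMod p) ≠ 0 := by
    rw [Ne, ZMod.natCast_eq_zero_iff]
    intro h
    exact hp2 ((Nat.prime_dvd_prime_iff_eq Fact.out Nat.prime_two).1 h)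
  exact_mod_cast this

open Classical in
/-- The involution `x ↦ 1 - x` has the single fixed point `1 / 2`. -/
theorem even_card_filter_one_sub {S : Finset (ZMod p)} (hp2 : p ≠ 2)
    (hS : ∀ x ∈ S, 1 - x ∈ S) (h2 : (2 : ZMod p)⁻¹ ∉ S) : Even S.card := by
  have h20 := two_ne_zero_of_ne_two hp2
  have := Finset.sum_involution (s := S) (f := fun _ => (1 : ZMod 2)) (fun x _ => 1 - x)
    (fun _ _ => by decide) (fun x hx _ hfix => h2 ?_) hS (fun x _ => by ring)
  · rw [Finset.sum_const, nsmul_eq_mul, mul_one, ZMod.natCast_eq_zero_iff] at this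
    exact even_iff_two_dvd.2 this
  · have h : x = (2 : ZMod p)⁻¹ := by
      refine eq_inv_of_mul_eq_one_left ?_
      linear_combination -hfix
    rwa [← h]

/-- The quartic Jacobi sum `J(χ, χ) = A + B i`, with its norm and its residues modulo `4` and `p`.
-/
theorem exists_jacobiSum_eq (hp : p % 4 = 1) (hg : ∀ x : (ZMod p)ˣ, x ∈ Subgroup.zpowers g)
    (hχ : χ (g : ZMod p) = I) :
    ∃ A B : ℤ, jacobiSum χ χ = A + B * I ∧ A ^ 2 + B ^ 2 = p ∧ A ≡ -1 [ZMOD 4] ∧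
      (B : ZMod p) = A * (g : ZMod p) ^ ((p - 1) / 4) := by
  classical
  obtain ⟨f, hf⟩ : ∃ f, p = 4 * f + 1 := ⟨p / 4, by omega⟩
  have hcard : Fintype.card (ZMod p) = 4 * f + 1 := by rw [ZMod.card, hf]
  have hfp : (p - 1) / 4 = f := by omega
  rw [hfp]
  have hf0 : 0 < f := by
    have := (Fact.out : p.Prime).two_le
    omega
  set w : ZMod p := (g : ZMod p) ^ f with hw
  have hw2 : w ^ 2 = -1 := pow_card_sub_one_div_two hg hcard
  set u : ZMod p → ZMod p := fun x => x * (1 - x) with hu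
  set n : ℕ → ℕ := fun c => (Finset.univ.filter fun x => χ (u x) = I ^ c).card with hn
  have hI4 : I ^ 4 = 1 := I_pow_four
  have hJ : jacobiSum χ χ = ((n 0 - n 2 : ℤ) : ℂ) + ((n 1 - n 3 : ℤ) : ℂ) * I := by
    have := sum_comp_eq_sum_card_mul_pow hg hχ (φ := χ) hI4 (MulChar.map_zero χ)
      (fun k => by rw [map_pow, hχ]) u
    rw [jacobiSum]
    simp only [hu, map_mul] at this ⊢
    rw [this]
    simp only [Finset.sum_range_succ, Finset.sum_range_zero, hn, hu, map_mul]
    push_cast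
    rw [I_pow_three, I_sq]
    ring
  -- Counting all `x ≠ 0, 1`.
  have hone : (p : ℤ) - 2 = n 0 + n 1 + n 2 + n 3 := by
    have := sum_comp_eq_sum_card_mul_pow hg hχ (φ := fun y : ZMod p => if y = 0 then (0 : ℤ) else 1)
      (Z := 1) (by norm_num) (by simp) (fun k => by simp) u
    simp only [Finset.sum_range_succ, Finset.sum_range_zero, one_pow, mul_one, zero_add] at this
    rw [← this]
    have h1 : ∀ x : ZMod p, (if u x = 0 then (0 : ℤ) else 1) =
        1 - (if x = 0 then 1 else 0) - (if x = 1 then 1 else 0) := by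
      intro x
      by_cases hx0 : x = 0
      · simp [hu, hx0]
      by_cases hx1 : x = 1
      · simp [hu, hx1]
      have : u x ≠ 0 := mul_ne_zero hx0 (sub_ne_zero.2 (Ne.symm hx1))
      simp [this, hx0, hx1]
    rw [Finset.sum_congr rfl fun x _ => h1 x]
    simp only [Finset.sum_sub_distrib, Finset.sum_ite_eq', Finset.mem_univ, if_true,
      Finset.sum_const, Finset.card_univ, ZMod.card]
    simp; ring
  -- Reducing `J(χ, χ)` modulo the prime above `p` that sends `i` to `w`.
  have hmod : ((n 0 - n 2 : ℤ) : ZMod p) + ((n 1 - n 3 : ℤ) : ZMod p) * w = 0 := by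
    have := sum_comp_eq_sum_card_mul_pow hg hχ (φ := fun y : ZMod p => y ^ f)
      (Z := w) (by rw [show (4 : ℕ) = 2 * 2 by rfl, pow_mul, hw2]; norm_num)
      (zero_pow hf0.ne') (fun k => by rw [hw, ← pow_mul, ← pow_mul, mul_comm]) u
    rw [sum_pow_mul_one_sub_pow hcard] at this
    simp only [Finset.sum_range_succ, Finset.sum_range_zero] at this
    push_cast
    rw [pow_succ w 2, hw2] at this
    linear_combination -this
  have hnorm : ((n 0 - n 2 : ℤ)) ^ 2 + ((n 1 - n 3 : ℤ)) ^ 2 = (p : ℤ) := by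
    obtain ⟨h1, h2, -⟩ := quarticChar_pow_ne_one hχ
    have h := jacobiSum_mul_jacobiSum_inv (F' := ℂ) (F := ZMod p) (by
      rw [ringChar.eq_zero]; exact (CharP.ringChar_ne_zero_of_finite (ZMod p)).symm)
      h1 h1 (by rwa [← sq])
    have hc : jacobiSum χ⁻¹ χ⁻¹ = conj (jacobiSum χ χ) := by
      rw [jacobiSum, jacobiSum, map_sum]
      refine Finset.sum_congr rfl fun x _ => ?_
      rw [map_mul, ← MulChar.star_apply', ← MulChar.star_apply']
      rfl
    rw [hc, hJ, ZMod.card] at h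
    have h3 : ((((n 0 - n 2 : ℤ)) ^ 2 + ((n 1 - n 3 : ℤ)) ^ 2 : ℤ) : ℂ) = ((p : ℤ) : ℂ) := by
      rw [Int.cast_natCast, ← h]
      simp only [map_add, map_mul, conj_I, map_intCast]
      push_cast
      linear_combination ((n 1 - n 3 : ℂ) ^ 2) * I_sq
    exact_mod_cast h3
  have hp2 : p ≠ 2 := by omega
  have h20 : (2 : ZMod p) ≠ 0 := two_ne_zero_of_ne_two hp2
  have hsub : 1 - (2 : ZMod p)⁻¹ = 2⁻¹ := by field_simp; norm_num
  have hu2 : u (2 : ZMod p)⁻¹ = (2⁻¹) ^ 2 := by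
    simp only [hu, hsub, sq]
  obtain ⟨s, hs⟩ := exists_eq_pow hg (inv_ne_zero h20)
  have hχ2 : χ (u 2⁻¹) = I ^ (2 * s) := by
    rw [hu2, hs, ← pow_mul, map_pow, hχ, mul_comm]
  -- The values of `χ` on `x (1 - x)` pair off, except for the one at `x = 1 / 2`.
  have heven : ∀ P : ℂ → Prop, (Finset.univ.filter fun x => P (χ (u x))).card % 2 =
      if P (I ^ (2 * s)) then 1 else 0 := by
    intro P
    set S : Finset (ZMod p) := Finset.univ.filter fun x => P (χ (u x)) with hS
    have hSinv : ∀ x ∈ S, 1 - x ∈ S := by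
      intro x hx
      have husymm : u (1 - x) = u x := by simp only [hu]; ring
      rw [hS, Finset.mem_filter] at hx ⊢
      rw [husymm]
      exact ⟨Finset.mem_univ _, hx.2⟩
    have hmem : (2 : ZMod p)⁻¹ ∈ S ↔ P (I ^ (2 * s)) := by
      rw [hS, Finset.mem_filter, hχ2, and_iff_right (Finset.mem_univ _)]
    rw [← if_congr hmem rfl rfl]
    split_ifs with hm
    · have h1 := even_card_filter_one_sub (S := S.erase 2⁻¹) hp2 (fun x hx => ?_)
        (Finset.notMem_erase _ _)
      · have h2 := Finset.card_erase_add_one hm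
        rw [Nat.even_iff] at h1
        omega
      · rw [Finset.mem_erase] at hx ⊢
        refine ⟨fun h => hx.1 ?_, hSinv x hx.2⟩
        rw [← sub_sub_cancel 1 x, h, hsub]
    · exact Nat.even_iff.1 (even_card_filter_one_sub hp2 hSinv hm)
  have hadd : ∀ c d : ℕ, ¬ c ≡ d [MOD 4] → (n c + n d) % 2 =
      if I ^ (2 * s) = I ^ c ∨ I ^ (2 * s) = I ^ d then 1 else 0 := by
    intro c d hcd
    have h0 := heven fun z => z = I ^ c ∨ z = I ^ d
    have hcard' : (Finset.univ.filter fun x => χ (u x) = I ^ c ∨ χ (u x) = I ^ d).card =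
        n c + n d := by
      rw [Finset.filter_or, Finset.card_union_of_disjoint]
      rw [Finset.disjoint_filter]
      intro x _ h1 h2
      rw [h1, I_pow_eq_I_pow_iff] at h2
      exact hcd h2
    rw [← hcard']
    convert h0
  -- `χ(1 / 4)` is `1` or `-1`, as `1 / 4` is a square.
  have hpar13 : (n 1 + n 3) % 2 = 0 := by
    rw [hadd 1 3 (by decide), if_neg]
    simp only [I_pow_eq_I_pow_iff, Nat.ModEq]
    omega
  -- `χ(1 / 4) = -1` exactly when `2` is not a square, that is, when `f` is odd.
  have hpar23 : (n 2 + n 3) % 2 = f % 2 := by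
    have hsq : IsSquare (2 : ZMod p) ↔ s % 2 = 0 := by
      rw [← isSquare_inv]
      constructor
      · rintro ⟨r, hr⟩
        have hr0 : r ≠ 0 := by
          rintro rfl
          exact inv_ne_zero h20 (by simpa using hr)
        obtain ⟨k, rfl⟩ := exists_eq_pow hg hr0
        rw [hs, ← pow_add] at hr
        have := congrArg χ hr
        rw [map_pow, map_pow, hχ, I_pow_eq_I_pow_iff, Nat.ModEq] at this
        omega
      · intro h
        rw [hs]
        exact ⟨(g : ZMod p) ^ (s / 2), by rw [← pow_add]; congr 1; omega⟩
    have := ZMod.exists_sq_eq_two_iff (p := p) hp2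
    rw [hsq] at this
    rw [hadd 2 3 (by decide)]
    simp only [I_pow_eq_I_pow_iff, Nat.ModEq]
    split_ifs <;> omega
  refine ⟨n 0 - n 2, n 1 - n 3, hJ, hnorm, ?_, ?_⟩
  · obtain ⟨c, hc⟩ : ∃ c : ℤ, (n 1 - n 3 : ℤ) = 2 * c := ⟨(n 1 - n 3 : ℤ) / 2, by omega⟩
    obtain ⟨e, he⟩ : ∃ e : ℤ, (n 0 - n 2 : ℤ) = 2 * e + 1 := ⟨(n 0 - n 2 : ℤ) / 2, by omega⟩
    rw [hc, he, hf] at hnorm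
    push_cast at hnorm
    -- `A` is odd and `B = 2 c`, so `A ^ 2 + B ^ 2 = 4 f + 1` modulo `8` gives the parity of `c`.
    have hcf : (c - f) % 2 = 0 := by
      have h1 : e * (e + 1) % 2 = 0 := Int.even_iff.1 (Int.even_mul_succ_self e)
      have h2 : (c ^ 2 - c) % 2 = 0 := by
        rw [show c ^ 2 - c = (c - 1) * (c - 1 + 1) by ring]
        exact Int.even_iff.1 (Int.even_mul_succ_self (c - 1))
      have h3 : e * (e + 1) + c ^ 2 = f := by linarith
      omega
    rw [Int.ModEq]
    omega
  · linear_combination (-(g : ZMod p) ^ f) * hmod + ((n 1 - n 3 : ℤ) : ZMod p) * hw2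

end JacobiSum

/-! ### Evaluation of the Jacobi sum and relations between Gauss sums -/

section Evaluation

/-- A prime is a sum of two squares in essentially one way; the congruences fix the signs. -/
theorem eq_and_eq_of_sq_add_sq {p : ℕ} [Fact p.Prime] (hp : p % 4 = 1)
    {A B a b : ℤ} {w : ZMod p} (hw : w ^ 2 = -1)
    (hAB : A ^ 2 + B ^ 2 = p) (hab : a ^ 2 + b ^ 2 = p)
    (hA : A ≡ -1 [ZMOD 4]) (ha : a ≡ -1 [ZMOD 4])
    (hB : (B : ZMod p) = A * w) (hb : (b : ZMod p) = a * w) : A = a ∧ B = b := by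
  have hp0 : (p : ℤ) ≠ 0 := by exact_mod_cast (Fact.out : p.Prime).ne_zero
  -- `(A + B i)(a - b i) = p (s - t i)`, where `s - t i` is a Gaussian integer of norm `1`.
  obtain ⟨s, hs⟩ : (p : ℤ) ∣ A * a + B * b := by
    rw [← ZMod.intCast_zmod_eq_zero_iff_dvd]
    push_cast
    rw [hB, hb]
    linear_combination (A * a : ZMod p) * hw
  obtain ⟨t, ht⟩ : (p : ℤ) ∣ A * b - a * B := by
    rw [← ZMod.intCast_zmod_eq_zero_iff_dvd]
    push_cast
    rw [hB, hb]
    ring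
  have hst : s ^ 2 + t ^ 2 = 1 := by
    have : (p : ℤ) ^ 2 * (s ^ 2 + t ^ 2) = (p : ℤ) ^ 2 * 1 := by
      calc (p : ℤ) ^ 2 * (s ^ 2 + t ^ 2) = (p * s) ^ 2 + (p * t) ^ 2 := by ring
        _ = (A ^ 2 + B ^ 2) * (a ^ 2 + b ^ 2) := by rw [← hs, ← ht]; ring
        _ = _ := by rw [hAB, hab]; ring
    exact mul_left_cancel₀ (pow_ne_zero 2 hp0) this
  have h1 : a = A * s - B * t := by
    apply mul_left_cancel₀ hp0
    calc (p : ℤ) * a = A * (A * a + B * b) - B * (A * b - a * B) := by rw [← hAB]; ring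
      _ = _ := by rw [hs, ht]; ring
  have h2 : b = B * s + A * t := by
    apply mul_left_cancel₀ hp0
    calc (p : ℤ) * b = B * (A * a + B * b) + A * (A * b - a * B) := by rw [← hAB]; ring
      _ = _ := by rw [hs, ht]; ring
  rw [Int.ModEq] at hA ha
  have hBeven : B % 2 = 0 := by
    by_contra hodd
    obtain ⟨x, hx⟩ : ∃ x, A = 2 * x + 1 := ⟨A / 2, by omega⟩
    obtain ⟨y, hy⟩ : ∃ y, B = 2 * y + 1 := ⟨B / 2, by omega⟩
    have : 4 * (x ^ 2 + x + y ^ 2 + y) + 2 = (p : ℤ) := by rw [← hAB, hx, hy]; ring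
    omega
  have hs1 : s ≤ 1 := by nlinarith
  have hs2 : -1 ≤ s := by nlinarith
  have ht1 : t ≤ 1 := by nlinarith
  have ht2 : -1 ≤ t := by nlinarith
  -- The units `±i` would make `a` even, and `-1` contradicts the congruences modulo `4`.
  interval_cases s <;> interval_cases t <;> simp at hst <;> omega

variable {p : ℕ} [Fact p.Prime] {g : (ZMod p)ˣ} {χ : MulChar (ZMod p) ℂ}

theorem legendreSym_two_eq_neg_one_pow (hp : p % 4 = 1) :
    legendreSym p 2 = (-1) ^ ((p - 1) / 4) := by
  have hp2 : p ≠ 2 := by omega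
  rw [legendreSym.at_two hp2, ZMod.χ₈_nat_eq_if_mod_eight, if_neg (by omega)]
  split_ifs with h
  · exact (Even.neg_one_pow (Nat.even_iff.2 (by omega))).symm
  · exact (Odd.neg_one_pow (Nat.odd_iff.2 (by omega))).symm

/-- The factor `(-1) ^ f` in `π` is the Legendre symbol of `2`, which makes the real part of `π`
congruent to `-1` modulo `4`, as that of the Jacobi sum. -/
theorem jacobiSum_eq_quarticPi (hp : p % 4 = 1) (hg : ∀ x : (ZMod p)ˣ, x ∈ Subgroup.zpowers g)
    (hχ : χ (g : ZMod p) = I) {a₄ b₄ : ℤ} (hab : a₄ ^ 2 + b₄ ^ 2 = (p : ℤ))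
    (ha₄ : a₄ ≡ -legendreSym p 2 [ZMOD 4])
    (hb₄ : (b₄ : ZMod p) = (a₄ : ZMod p) * (g : ZMod p) ^ ((p - 1) / 4)) :
    jacobiSum χ χ = quarticPi p a₄ b₄ := by
  obtain ⟨A, B, hJ, hAB, hA, hB⟩ := exists_jacobiSum_eq hp hg hχ
  rw [legendreSym_two_eq_neg_one_pow hp] at ha₄
  set f := (p - 1) / 4 with hf
  have hw : ((g : ZMod p) ^ f) ^ 2 = -1 :=
    pow_card_sub_one_div_two hg (by rw [ZMod.card]; omega)
  have hsq : ((-1 : ℤ) ^ f) ^ 2 = 1 := by rw [← pow_mul, mul_comm, pow_mul]; norm_num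
  obtain ⟨h1, h2⟩ := eq_and_eq_of_sq_add_sq (a := (-1) ^ f * a₄) (b := (-1) ^ f * b₄) hp hw hAB
    (by linear_combination (a₄ ^ 2 + b₄ ^ 2) * hsq + hab) hA
    (by
      have := ha₄.mul_left ((-1) ^ f)
      rwa [show (-1 : ℤ) ^ f * -(-1) ^ f = -1 by linear_combination -hsq] at this)
    hB (by push_cast; rw [hb₄]; ring)
  rw [hJ, h1, h2, quarticPi]
  push_cast
  ring

theorem quadChar_eq (hg : ∀ x : (ZMod p)ˣ, x ∈ Subgroup.zpowers g)
    (hχ : χ (g : ZMod p) = I) (x : ZMod p) : (quadChar p x : ℂ) = (χ ^ 2) x := by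
  have h2 : ∀ y, (χ ^ 2) y = χ y ^ 2 := fun y => MulChar.pow_apply' χ two_ne_zero y
  have hgq : quadraticChar (ZMod p) g = -1 := by
    rw [quadraticChar_neg_one_iff_not_isSquare]
    rintro ⟨r, hr⟩
    have hr0 : r ≠ 0 := by
      rintro rfl
      simp at hr
    obtain ⟨k, rfl⟩ := exists_eq_pow hg hr0
    have := congrArg χ hr
    rw [map_mul, map_pow, hχ, ← pow_add] at this
    have h3 : I ^ 1 = I ^ (k + k) := by rwa [pow_one]
    rw [I_pow_eq_I_pow_iff, Nat.ModEq] at h3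
    omega
  by_cases hx : x = 0
  · subst hx
    rw [MulChar.map_zero, quadChar, MulChar.map_zero]; simp
  · obtain ⟨k, rfl⟩ := exists_eq_pow hg hx
    rw [h2, quadChar, map_pow, map_pow, hgq, hχ, ← pow_mul, mul_comm k, pow_mul, I_sq]
    push_cast; rfl

theorem gaussSum_mul_gaussSum_inv {F : Type*} [Field F] [Fintype F] {θ : MulChar F ℂ} (hθ : θ ≠ 1)
    {ψ : AddChar F ℂ} (hψ : ψ.IsPrimitive) :
    gaussSum θ ψ * gaussSum θ⁻¹ ψ = θ (-1) * Fintype.card F := by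
  have h1 := gaussSum_mul_gaussSum_eq_card hθ hψ
  have h2 := mul_gaussSum_inv_eq_gaussSum θ⁻¹ ψ
  have h3 : θ⁻¹ (-1) = θ (-1) := by
    rw [MulChar.inv_apply', inv_neg, inv_one]
  rw [← h2, h3, ← h1]; ring

/-- The relations between the quartic Gauss sums `G(χ)`, `G(χ⁻¹)` and the quadratic Gauss sum
`G(χ ^ 2)`. -/
theorem gaussSum_relations (hp : p % 4 = 1) (hg : ∀ x : (ZMod p)ˣ, x ∈ Subgroup.zpowers g)
    (hχ : χ (g : ZMod p) = I) {ψ : AddChar (ZMod p) ℂ} (hψ : ψ.IsPrimitive) :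
    gaussSum (χ ^ 2) ψ ^ 2 = p ∧ gaussSum χ ψ ^ 2 = jacobiSum χ χ * gaussSum (χ ^ 2) ψ ∧
      gaussSum χ ψ * gaussSum χ⁻¹ ψ = (-1) ^ ((p - 1) / 4) * p := by
  obtain ⟨h1, h2, -⟩ := quarticChar_pow_ne_one hχ
  have hm1 : χ (-1) = (-1) ^ ((p - 1) / 4) := char_neg_one hg hχ (by rw [ZMod.card]; omega)
  refine ⟨?_, ?_, ?_⟩
  · have h := gaussSum_mul_gaussSum_inv h2 hψ
    have h3 : (χ ^ 2)⁻¹ = χ ^ 2 := by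
      rw [inv_eq_iff_mul_eq_one, ← pow_add]; exact pow_four_eq_one hg hχ
    rw [h3, MulChar.pow_apply' χ two_ne_zero, hm1, ZMod.card, ← pow_mul, mul_comm _ 2,
      pow_mul] at h
    rw [sq, h]; norm_num
  · rw [sq, ← jacobiSum_mul_nontrivial (by rwa [← sq]) ψ, ← sq, mul_comm]
  · rw [gaussSum_mul_gaussSum_inv h1 hψ, hm1, ZMod.card]

end Evaluation

/-! ### Counting elements by trace and norm class -/

section Counting

variable {p : ℕ} [Fact p.Prime] {g : (ZMod p)ˣ} {χ : MulChar (ZMod p) ℂ}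

/-- The number of elements with prescribed trace and norm class as a combination of the sums of
the powers of `χ` over a trace fibre. -/
theorem four_mul_traceNormCount {L : Type*} [Field L] [Algebra (ZMod p) L]
    [FiniteDimensional (ZMod p) L]
    (hg : ∀ x : (ZMod p)ˣ, x ∈ Subgroup.zpowers g) (hχ : χ (g : ZMod p) = I)
    (E : IntermediateField (ZMod p) L) [Fintype E] (a : ZMod p) (h : ℕ)
    (hn : ((Module.finrank E L : ℕ) : ZMod p) ≠ 0) :
    4 * (traceNormCount g E a 4 h : ℂ) = ∑ j ∈ Finset.range 4,
      I ^ (3 * h * j) * traceFibreSum E (χ ^ (Module.finrank E L * j))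
        (a / (Module.finrank E L : ℕ)) := by
  classical
  set n := Module.finrank E L with hndef
  have hset : traceNormSet g E a 4 h = (fun x : E => (x : L)) ''
      ((Finset.univ.filter fun x : E => Algebra.trace (ZMod p) E x = a / (n : ℕ) ∧
        χ (Algebra.norm (ZMod p) x ^ n) = I ^ h : Finset E) : Set E) := by
    ext x
    simp only [traceNormSet, Set.mem_ofPred_eq, Set.mem_image, Finset.coe_filter, Finset.mem_univ,
      true_and, mem_powCoset_four_iff hg hχ]
    have htr : ∀ y : E, Algebra.trace (ZMod p) L (y : L) = n * Algebra.trace (ZMod p) E y := by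
      intro y
      rw [← Algebra.trace_trace (S := E),
        show (y : L) = algebraMap E L y from rfl, Algebra.trace_algebraMap,
        LinearMap.map_smul_of_tower, nsmul_eq_mul]
    have hno : ∀ y : E, Algebra.norm (ZMod p) (y : L) = Algebra.norm (ZMod p) y ^ n := by
      intro y
      rw [← Algebra.norm_norm (S := E),
        show (y : L) = algebraMap E L y from rfl, Algebra.norm_algebraMap, map_pow]
    constructor
    · rintro ⟨hx, h1, h2⟩
      refine ⟨⟨x, hx⟩, ⟨?_, ?_⟩, rfl⟩
      · rw [eq_div_iff hn, mul_comm, ← htr]; exact h1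
      · rw [← hno]; exact h2
    · rintro ⟨y, ⟨h1, h2⟩, rfl⟩
      refine ⟨y.2, ?_, ?_⟩
      · rw [htr, h1, mul_div_cancel₀ _ hn]
      · rw [hno]; exact h2
  have hcount : (traceNormCount g E a 4 h : ℂ) = ∑ x : E with
      Algebra.trace (ZMod p) E x = a / (n : ℕ),
      if χ (Algebra.norm (ZMod p) x ^ n) = I ^ h then 1 else 0 := by
    rw [traceNormCount, hset, Set.ncard_image_of_injective _ Subtype.val_injective,
      Set.ncard_coe_finset, ← Finset.filter_filter, Finset.card_filter]
    push_cast
    rfl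
  have hn0 : n ≠ 0 := by
    intro h0
    rw [h0] at hn
    simp at hn
  rw [hcount, Finset.mul_sum]
  simp only [traceFibreSum, Finset.mul_sum]
  rw [Finset.sum_comm]
  refine Finset.sum_congr (by congr) fun x _ => ?_
  have h1 : (4 : ℂ) * (if χ (Algebra.norm (ZMod p) x ^ n) = I ^ h then 1 else 0) =
      if χ (Algebra.norm (ZMod p) x ^ n) = I ^ h then 4 else 0 := by split_ifs <;> simp
  rw [h1, ← sum_pow_mul_I_pow hg hχ]
  refine Finset.sum_congr rfl fun j _ => ?_
  congr 1
  rw [map_pow, ← MulChar.pow_apply' _ hn0, ← pow_mul, mul_comm]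

variable {E : Type*} [Field E] [Fintype E] [Algebra (ZMod p) E]

/-- `χ ^ k` only depends on `k` modulo `4`. -/
theorem pow_char_mod_four (hg : ∀ x : (ZMod p)ˣ, x ∈ Subgroup.zpowers g)
    (hχ : χ (g : ZMod p) = I) (k : ℕ) : χ ^ k = χ ^ (k % 4) := by
  conv_lhs => rw [← Nat.div_add_mod k 4, pow_add, pow_mul, pow_four_eq_one hg hχ, one_pow, one_mul]

theorem char_inv_eq_pow_three (hg : ∀ x : (ZMod p)ˣ, x ∈ Subgroup.zpowers g)
    (hχ : χ (g : ZMod p) = I) : χ⁻¹ = χ ^ 3 := by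
  rw [inv_eq_iff_mul_eq_one, ← pow_succ', pow_four_eq_one hg hχ]

/-- For odd `n` the exponents `n * j` run through all residues modulo `4`, and substituting
`j ↦ n * j` replaces `h` by `i₀`, as `n ^ 2 ≡ 1 (mod 8)`; the terms of `χ` and `χ ^ 3` are complex
conjugates. -/
theorem sum_fibres_odd (hg : ∀ x : (ZMod p)ˣ, x ∈ Subgroup.zpowers g)
    (hχ : χ (g : ZMod p) = I) {n h i₀ : ℕ} (hn : n % 2 = 1) (hi : n * i₀ ≡ h [MOD 4])
    (b : ZMod p) :
    ∑ j ∈ Finset.range 4, I ^ (3 * h * j) * traceFibreSum E (χ ^ (n * j)) b =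
      traceFibreSum E 1 b + (-1) ^ i₀ * (traceFibreSum E (χ ^ 2) b +
        2 * ((traceFibreSum E χ b * I ^ i₀).re : ℂ)) := by
  have hre : (2 * ((traceFibreSum E χ b * I ^ i₀).re : ℂ)) =
      traceFibreSum E χ b * I ^ i₀ + traceFibreSum E (χ ^ 3) b * I ^ (3 * i₀) := by
    have h1 := Complex.add_conj (traceFibreSum E χ b * I ^ i₀)
    push_cast at h1
    rw [← h1, map_mul, conj_traceFibreSum, map_pow, conj_I, char_inv_eq_pow_three hg hχ,
      pow_mul, I_pow_three]
  have hsgn : ((-1 : ℂ)) ^ i₀ = I ^ (2 * i₀) := by rw [pow_mul, I_sq]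
  rw [hre, hsgn]
  simp only [Finset.sum_range_succ, Finset.sum_range_zero, zero_add, mul_zero, pow_zero, one_mul]
  have hn4 : n % 4 = 1 ∨ n % 4 = 3 := by omega
  rw [mul_add, mul_add, mul_left_comm _ (traceFibreSum E χ b),
    mul_left_comm _ (traceFibreSum E (χ ^ 3) b), ← pow_add, ← pow_add]
  have hh : h % 4 = ((n % 4) * (i₀ % 4)) % 4 := by rw [← hi, ← Nat.mul_mod]
  rcases hn4 with h4 | h4 <;> rw [h4] at hh
  · rw [pow_char_mod_four hg hχ (n * 1), pow_char_mod_four hg hχ (n * 2),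
      pow_char_mod_four hg hχ (n * 3), show n * 1 % 4 = 1 by omega, show n * 2 % 4 = 2 by omega,
      show n * 3 % 4 = 3 by omega, pow_one]
    rw [show I ^ (3 * h * 1) = I ^ (2 * i₀ + i₀) from I_pow_eq_I_pow_iff.2 (by
        unfold Nat.ModEq; omega),
      show I ^ (3 * h * 2) = I ^ (2 * i₀) from I_pow_eq_I_pow_iff.2 (by unfold Nat.ModEq; omega),
      show I ^ (3 * h * 3) = I ^ (2 * i₀ + 3 * i₀) from I_pow_eq_I_pow_iff.2 (by
        unfold Nat.ModEq; omega)]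
    ring
  · rw [pow_char_mod_four hg hχ (n * 1), pow_char_mod_four hg hχ (n * 2),
      pow_char_mod_four hg hχ (n * 3), show n * 1 % 4 = 3 by omega, show n * 2 % 4 = 2 by omega,
      show n * 3 % 4 = 1 by omega, pow_one]
    rw [show I ^ (3 * h * 1) = I ^ (2 * i₀ + 3 * i₀) from I_pow_eq_I_pow_iff.2 (by
        unfold Nat.ModEq; omega),
      show I ^ (3 * h * 2) = I ^ (2 * i₀) from I_pow_eq_I_pow_iff.2 (by unfold Nat.ModEq; omega),
      show I ^ (3 * h * 3) = I ^ (2 * i₀ + i₀) from I_pow_eq_I_pow_iff.2 (by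
        unfold Nat.ModEq; omega)]
    ring

/-- For `n ≡ 2 (mod 4)` only the characters `1` and `χ ^ 2` occur, each of them twice. -/
theorem sum_fibres_two_mod_four (hg : ∀ x : (ZMod p)ˣ, x ∈ Subgroup.zpowers g)
    (hχ : χ (g : ZMod p) = I) {n h i₀ : ℕ} (hn : n % 4 = 2) (hh : h % 2 = 0)
    (hi : n / 2 * i₀ ≡ h / 2 [MOD 2]) (b : ZMod p) :
    ∑ j ∈ Finset.range 4, I ^ (3 * h * j) * traceFibreSum E (χ ^ (n * j)) b =
      2 * (traceFibreSum E 1 b + (-1) ^ i₀ * traceFibreSum E (χ ^ 2) b) := by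
  have hsgn : ((-1 : ℂ)) ^ i₀ = I ^ (2 * i₀) := by rw [pow_mul, I_sq]
  have hh2 : h / 2 % 2 = ((n / 2 % 2) * (i₀ % 2)) % 2 := by rw [← hi, ← Nat.mul_mod]
  rw [show n / 2 % 2 = 1 by omega] at hh2
  simp only [Finset.sum_range_succ, Finset.sum_range_zero, zero_add, mul_zero, pow_zero, one_mul]
  rw [pow_char_mod_four hg hχ (n * 1), pow_char_mod_four hg hχ (n * 2),
    pow_char_mod_four hg hχ (n * 3), show n * 1 % 4 = 2 by omega, show n * 2 % 4 = 0 by omega,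
    show n * 3 % 4 = 2 by omega, pow_zero, hsgn]
  rw [show I ^ (3 * h * 1) = I ^ (2 * i₀) from I_pow_eq_I_pow_iff.2 (by unfold Nat.ModEq; omega),
    show I ^ (3 * h * 2) = I ^ 0 from I_pow_eq_I_pow_iff.2 (by unfold Nat.ModEq; omega),
    show I ^ (3 * h * 3) = I ^ (2 * i₀) from I_pow_eq_I_pow_iff.2 (by
      unfold Nat.ModEq; omega)]
  ring

theorem sum_fibres_zero_mod_four (hg : ∀ x : (ZMod p)ˣ, x ∈ Subgroup.zpowers g)
    (hχ : χ (g : ZMod p) = I) {n : ℕ} (hn : n % 4 = 0) (b : ZMod p) :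
    ∑ j ∈ Finset.range 4, I ^ (3 * 0 * j) * traceFibreSum E (χ ^ (n * j)) b =
      4 * traceFibreSum E 1 b := by
  simp only [Finset.sum_range_succ, Finset.sum_range_zero, zero_add, mul_zero, pow_zero, one_mul,
    zero_mul]
  rw [pow_char_mod_four hg hχ (n * 1), pow_char_mod_four hg hχ (n * 2),
    pow_char_mod_four hg hχ (n * 3), show n * 1 % 4 = 0 by omega, show n * 2 % 4 = 0 by omega,
    show n * 3 % 4 = 0 by omega, pow_zero]
  ring

end Counting

/-! ### The values of the fibre sums -/

section FibreValues

variable {p : ℕ} [Fact p.Prime] {g : (ZMod p)ˣ} {χ : MulChar (ZMod p) ℂ}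
variable {E : Type*} [Field E] [Fintype E] [Algebra (ZMod p) E]

theorem traceFibreSum_sq_zero_of_odd (hg : ∀ x : (ZMod p)ˣ, x ∈ Subgroup.zpowers g)
    (hχ : χ (g : ZMod p) = I) (ht : Module.finrank (ZMod p) E % 2 = 1) :
    traceFibreSum E (χ ^ 2) 0 = 0 := by
  have hp0 : (p : ℂ) ≠ 0 := by exact_mod_cast (Fact.out : p.Prime).ne_zero
  have h := traceFibreSum_zero (E := E) (quarticChar_pow_ne_one hχ).2.1
    (AddChar.FiniteField.primitiveChar_to_Complex_isPrimitive (ZMod p))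
  rw [ZMod.card, ← pow_mul, pow_char_mod_four hg hχ (2 * _),
    show 2 * Module.finrank (ZMod p) E % 4 = 2 by omega,
    if_neg (quarticChar_pow_ne_one hχ).2.1, mul_zero] at h
  exact (mul_eq_zero.1 h).resolve_left hp0

theorem traceFibreSum_zero_of_not_dvd (hg : ∀ x : (ZMod p)ˣ, x ∈ Subgroup.zpowers g)
    (hχ : χ (g : ZMod p) = I) (ht : Module.finrank (ZMod p) E % 4 ≠ 0) :
    traceFibreSum E χ 0 = 0 := by
  have hp0 : (p : ℂ) ≠ 0 := by exact_mod_cast (Fact.out : p.Prime).ne_zero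
  obtain ⟨h1, h2, h3⟩ := quarticChar_pow_ne_one hχ
  have h := traceFibreSum_zero (E := E) h1
    (AddChar.FiniteField.primitiveChar_to_Complex_isPrimitive (ZMod p))
  rw [ZMod.card, if_neg, mul_zero] at h
  · exact (mul_eq_zero.1 h).resolve_left hp0
  · rw [pow_char_mod_four hg hχ]
    have hlt : Module.finrank (ZMod p) E % 4 < 4 := Nat.mod_lt _ (by norm_num)
    generalize Module.finrank (ZMod p) E % 4 = r at *
    interval_cases r
    · exact absurd rfl ht
    · rwa [pow_one]
    · exact h2
    · exact h3

variable (hp : p % 4 = 1) (hg : ∀ x : (ZMod p)ˣ, x ∈ Subgroup.zpowers g)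
  (hχ : χ (g : ZMod p) = I)
include hp hg hχ

theorem traceFibreSum_sq_of_odd {b : ZMod p} (hb : b ≠ 0) {k : ℕ}
    (ht : Module.finrank (ZMod p) E = 2 * k + 1) :
    traceFibreSum E (χ ^ 2) b = (p : ℂ) ^ k * (χ ^ 2) b := by
  have hp0 : (p : ℂ) ≠ 0 := by exact_mod_cast (Fact.out : p.Prime).ne_zero
  have hψ := AddChar.FiniteField.primitiveChar_to_Complex_isPrimitive (ZMod p)
  have h := traceFibreSum_of_ne_zero (E := E) (quarticChar_pow_ne_one hχ).2.1 hψ hb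
  obtain ⟨hG2, -, -⟩ := gaussSum_relations hp hg hχ hψ
  have hm : (χ ^ 2) (-b) = (χ ^ 2) b := by
    rw [MulChar.pow_apply' _ two_ne_zero, MulChar.pow_apply' _ two_ne_zero, ← map_pow, ← map_pow,
      neg_sq]
  have hinv : (χ ^ 2)⁻¹ = χ ^ 2 := by
    rw [inv_eq_iff_mul_eq_one, ← pow_add]; exact pow_four_eq_one hg hχ
  have hpw : (χ ^ 2) ^ (2 * k + 1) = χ ^ 2 := by
    rw [← pow_mul, pow_char_mod_four hg hχ]; congr 1; omega
  rw [ZMod.card, ht, hpw, hm, hinv, Nat.add_sub_cancel, pow_mul, neg_one_sq, one_pow, one_mul] at h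
  apply mul_left_cancel₀ hp0
  rw [h]
  generalize gaussSum (χ ^ 2) (AddChar.FiniteField.primitiveChar_to_Complex (ZMod p)) = G at *
  have : G ^ (2 * k + 1) * G = (p : ℂ) * p ^ k := by
    rw [← pow_succ, show 2 * k + 1 + 1 = 2 * (k + 1) by ring, pow_mul, hG2]; ring
  linear_combination (χ ^ 2) b * this

open Classical in
theorem traceFibreSum_sq_of_even (b : ZMod p) {k : ℕ}
    (ht : Module.finrank (ZMod p) E = 2 * k + 2) :
    traceFibreSum E (χ ^ 2) b = if b = 0 then -((p : ℂ) ^ k * (p - 1)) else (p : ℂ) ^ k := by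
  have hp0 : (p : ℂ) ≠ 0 := by exact_mod_cast (Fact.out : p.Prime).ne_zero
  have hψ := AddChar.FiniteField.primitiveChar_to_Complex_isPrimitive (ZMod p)
  have hψ1 : AddChar.FiniteField.primitiveChar_to_Complex (ZMod p) ≠ 1 := by
    simpa using hψ one_ne_zero
  obtain ⟨hG2, -, -⟩ := gaussSum_relations hp hg hχ hψ
  have hpw : (χ ^ 2) ^ (2 * k + 2) = 1 := by
    rw [← pow_mul, pow_char_mod_four hg hχ, show 2 * (2 * k + 2) % 4 = 0 by omega, pow_zero]
  have hsgn : (-1 : ℂ) ^ (2 * k + 2 - 1) = -1 := Odd.neg_one_pow ⟨k, by omega⟩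
  have hG : gaussSum (χ ^ 2) (AddChar.FiniteField.primitiveChar_to_Complex (ZMod p)) ^ (2 * k + 2) =
      p * p ^ k := by
    rw [show 2 * k + 2 = 2 * (k + 1) by ring, pow_mul, hG2]; ring
  apply mul_left_cancel₀ hp0
  split_ifs with hb
  · have h := traceFibreSum_zero (E := E) (quarticChar_pow_ne_one hχ).2.1 hψ
    rw [ZMod.card, ht, hpw, if_pos rfl, hsgn, hG] at h
    rw [hb, h]; ring
  · have h := traceFibreSum_of_ne_zero (E := E) (quarticChar_pow_ne_one hχ).2.1 hψ hb
    rw [ZMod.card, ht, hpw, hsgn, hG, inv_one, gaussSum_one_left hψ1,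
      MulChar.one_apply (neg_ne_zero.2 hb).isUnit] at h
    rw [h]; ring

theorem gaussSum_pow_four_mul (k : ℕ) {ψ : AddChar (ZMod p) ℂ} (hψ : ψ.IsPrimitive) :
    gaussSum χ ψ ^ (4 * k) = jacobiSum χ χ ^ (2 * k) * (p : ℂ) ^ k := by
  obtain ⟨hG2, hG1, -⟩ := gaussSum_relations hp hg hχ hψ
  rw [show 4 * k = 2 * (2 * k) by ring, pow_mul, hG1, mul_pow, pow_mul (gaussSum (χ ^ 2) ψ), hG2]

theorem traceFibreSum_of_one_mod_four {b : ZMod p} (hb : b ≠ 0) {k : ℕ}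
    (ht : Module.finrank (ZMod p) E = 4 * k + 1) :
    traceFibreSum E χ b = (p : ℂ) ^ k * jacobiSum χ χ ^ (2 * k) * χ b := by
  have hp0 : (p : ℂ) ≠ 0 := by exact_mod_cast (Fact.out : p.Prime).ne_zero
  have hψ := AddChar.FiniteField.primitiveChar_to_Complex_isPrimitive (ZMod p)
  have h := traceFibreSum_of_ne_zero (E := E) (quarticChar_pow_ne_one hχ).1 hψ hb
  obtain ⟨-, -, hG⟩ := gaussSum_relations hp hg hχ hψ
  have hpw : χ ^ (4 * k + 1) = χ := by
    rw [pow_char_mod_four hg hχ, show (4 * k + 1) % 4 = 1 by omega, pow_one]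
  have hsgn : (-1 : ℂ) ^ (4 * k) = 1 := Even.neg_one_pow ⟨2 * k, by ring⟩
  have hm1 : χ (-1) = (-1) ^ ((p - 1) / 4) := char_neg_one hg hχ (by rw [ZMod.card]; omega)
  rw [ZMod.card, ht, hpw, Nat.add_sub_cancel, hsgn, pow_succ, gaussSum_pow_four_mul hp hg hχ k hψ,
    neg_eq_neg_one_mul, map_mul, hm1] at h
  have h1 : ((-1 : ℂ) ^ ((p - 1) / 4)) * (-1) ^ ((p - 1) / 4) = 1 := by
    rw [← mul_pow]; norm_num
  apply mul_left_cancel₀ hp0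
  rw [h]
  linear_combination (jacobiSum χ χ ^ (2 * k) * (p : ℂ) ^ k * (-1) ^ ((p - 1) / 4) * χ b) * hG +
    (jacobiSum χ χ ^ (2 * k) * (p : ℂ) ^ k * χ b * p) * h1

theorem traceFibreSum_of_three_mod_four {b : ZMod p} (hb : b ≠ 0) {k : ℕ}
    (ht : Module.finrank (ZMod p) E = 4 * k + 3) :
    traceFibreSum E χ b =
      (-1) ^ ((p - 1) / 4) * (p : ℂ) ^ k * jacobiSum χ χ ^ (2 * k + 2) * χ⁻¹ b := by
  have hp0 : (p : ℂ) ≠ 0 := by exact_mod_cast (Fact.out : p.Prime).ne_zero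
  have hψ := AddChar.FiniteField.primitiveChar_to_Complex_isPrimitive (ZMod p)
  have h := traceFibreSum_of_ne_zero (E := E) (quarticChar_pow_ne_one hχ).1 hψ hb
  have hpw : χ ^ (4 * k + 3) = χ⁻¹ := by
    rw [pow_char_mod_four hg hχ, show (4 * k + 3) % 4 = 3 by omega, char_inv_eq_pow_three hg hχ]
  have hsgn : (-1 : ℂ) ^ (4 * k + 3 - 1) = 1 := Even.neg_one_pow ⟨2 * k + 1, by omega⟩
  have hm1 : χ⁻¹ (-1) = (-1) ^ ((p - 1) / 4) := by
    rw [MulChar.inv_apply', inv_neg, inv_one]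
    exact char_neg_one hg hχ (by rw [ZMod.card]; omega)
  have hG := gaussSum_pow_four_mul hp hg hχ (k + 1) hψ
  rw [show 4 * (k + 1) = 4 * k + 3 + 1 by ring, pow_succ] at hG
  rw [ZMod.card, ht, hpw, inv_inv, hsgn, neg_eq_neg_one_mul, map_mul, hm1] at h
  apply mul_left_cancel₀ hp0
  rw [h]
  linear_combination (-1) ^ ((p - 1) / 4) * χ⁻¹ b * hG

theorem traceFibreSum_of_two_mod_four {b : ZMod p} (hb : b ≠ 0) {k : ℕ}
    (ht : Module.finrank (ZMod p) E = 4 * k + 2) :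
    traceFibreSum E χ b = -((p : ℂ) ^ k * jacobiSum χ χ ^ (2 * k + 1) * (χ ^ 2) b) := by
  have hp0 : (p : ℂ) ≠ 0 := by exact_mod_cast (Fact.out : p.Prime).ne_zero
  have hψ := AddChar.FiniteField.primitiveChar_to_Complex_isPrimitive (ZMod p)
  have h := traceFibreSum_of_ne_zero (E := E) (quarticChar_pow_ne_one hχ).1 hψ hb
  obtain ⟨hG2, hG1, -⟩ := gaussSum_relations hp hg hχ hψ
  have hpw : χ ^ (4 * k + 2) = χ ^ 2 := by
    rw [pow_char_mod_four hg hχ, show (4 * k + 2) % 4 = 2 by omega]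
  have hinv : (χ ^ 2)⁻¹ = χ ^ 2 := by
    rw [inv_eq_iff_mul_eq_one, ← pow_add]; exact pow_four_eq_one hg hχ
  have hsgn : (-1 : ℂ) ^ (4 * k + 2 - 1) = -1 := Odd.neg_one_pow ⟨2 * k, by omega⟩
  have hm : (χ ^ 2) (-b) = (χ ^ 2) b := by
    rw [MulChar.pow_apply' _ two_ne_zero, MulChar.pow_apply' _ two_ne_zero, ← map_pow, ← map_pow,
      neg_sq]
  rw [ZMod.card, ht, hpw, hinv, hsgn, hm, pow_add, gaussSum_pow_four_mul hp hg hχ k hψ, hG1] at h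
  apply mul_left_cancel₀ hp0
  rw [h]
  linear_combination (-jacobiSum χ χ ^ (2 * k + 1) * (p : ℂ) ^ k * (χ ^ 2) b) * hG2

open Classical in
theorem traceFibreSum_of_zero_mod_four (b : ZMod p) {k : ℕ}
    (ht : Module.finrank (ZMod p) E = 4 * k + 4) :
    traceFibreSum E χ b = if b = 0 then -((p : ℂ) ^ k * jacobiSum χ χ ^ (2 * k + 2) * (p - 1))
      else (p : ℂ) ^ k * jacobiSum χ χ ^ (2 * k + 2) := by
  have hp0 : (p : ℂ) ≠ 0 := by exact_mod_cast (Fact.out : p.Prime).ne_zero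
  have hψ := AddChar.FiniteField.primitiveChar_to_Complex_isPrimitive (ZMod p)
  have hψ1 : AddChar.FiniteField.primitiveChar_to_Complex (ZMod p) ≠ 1 := by
    simpa using hψ one_ne_zero
  have hpw : χ ^ (4 * k + 4) = 1 := by
    rw [pow_char_mod_four hg hχ, show (4 * k + 4) % 4 = 0 by omega, pow_zero]
  have hsgn : (-1 : ℂ) ^ (4 * k + 4 - 1) = -1 := Odd.neg_one_pow ⟨2 * k + 1, by omega⟩
  have hG := gaussSum_pow_four_mul hp hg hχ (k + 1) hψ
  rw [show 4 * (k + 1) = 4 * k + 4 by ring] at hG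
  apply mul_left_cancel₀ hp0
  split_ifs with hb
  · have h := traceFibreSum_zero (E := E) (quarticChar_pow_ne_one hχ).1 hψ
    rw [ZMod.card, ht, hpw, if_pos rfl, hsgn, hG] at h
    rw [hb, h]; ring
  · have h := traceFibreSum_of_ne_zero (E := E) (quarticChar_pow_ne_one hχ).1 hψ hb
    rw [ZMod.card, ht, hpw, hsgn, hG, inv_one, gaussSum_one_left hψ1,
      MulChar.one_apply (neg_ne_zero.2 hb).isUnit] at h
    rw [h]; ring

end FibreValues

/-! ### The parameters `d` and `l` -/

section Parameters

theorem gcd_four_eq (n : ℕ) :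
    Nat.gcd n 4 = if n % 2 = 1 then 1 else if n % 4 = 2 then 2 else 4 := by
  rw [Nat.gcd_comm, Nat.gcd_rec]
  have : n % 4 < 4 := Nat.mod_lt _ (by norm_num)
  rw [show n % 2 = n % 4 % 2 by omega]
  generalize n % 4 = r at *
  interval_cases r <;> rfl

theorem gcd_two_eq (n : ℕ) : Nat.gcd n 2 = if n % 2 = 1 then 1 else 2 := by
  rw [Nat.gcd_comm, Nat.gcd_rec]
  have : n % 2 < 2 := Nat.mod_lt _ (by norm_num)
  generalize n % 2 = r at *
  interval_cases r <;> rfl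

theorem params_mem (m t : ℕ) : (dParam m t 4, lParam m t 4) ∈
    ({(1, 1), (1, 2), (1, 4), (2, 1), (2, 2), (4, 1)} : Set (ℕ × ℕ)) := by
  simp only [lParam, dParam, gcd_four_eq (m / t)]
  split_ifs
  · rw [show 4 / 1 = 4 from rfl, gcd_four_eq]; split_ifs <;> simp
  · rw [show 4 / 2 = 2 from rfl, gcd_two_eq]; split_ifs <;> simp
  · rw [show 4 / 4 = 1 from rfl, Nat.gcd_one_right]; simp

theorem params_eq_one {m t l : ℕ} (h : (dParam m t 4, lParam m t 4) = (1, l)) :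
    m / t % 2 = 1 ∧ Nat.gcd t 4 = l := by
  rw [Prod.mk.injEq] at h
  obtain ⟨h1, h2⟩ := h
  rw [lParam, h1] at h2
  rw [dParam, gcd_four_eq] at h1
  refine ⟨?_, h2⟩
  split_ifs at h1 <;> omega

theorem params_eq_two {m t l : ℕ} (h : (dParam m t 4, lParam m t 4) = (2, l)) :
    m / t % 4 = 2 ∧ Nat.gcd t 2 = l := by
  rw [Prod.mk.injEq] at h
  obtain ⟨h1, h2⟩ := h
  rw [lParam, h1] at h2
  rw [dParam, gcd_four_eq] at h1
  refine ⟨?_, h2⟩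
  split_ifs at h1 <;> omega

theorem params_eq_four {m t l : ℕ} (h : (dParam m t 4, lParam m t 4) = (4, l)) :
    m / t % 4 = 0 := by
  rw [Prod.mk.injEq] at h
  obtain ⟨h1, -⟩ := h
  rw [dParam, gcd_four_eq] at h1
  split_ifs at h1 <;> omega

theorem gcd_four_eq_one {t : ℕ} (h : Nat.gcd t 4 = 1) : t % 2 = 1 := by
  rw [gcd_four_eq] at h
  split_ifs at h <;> omega

theorem gcd_four_eq_two {t : ℕ} (h : Nat.gcd t 4 = 2) : t % 4 = 2 := by
  rw [gcd_four_eq] at h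
  split_ifs at h <;> omega

theorem gcd_four_eq_four {t : ℕ} (h : Nat.gcd t 4 = 4) : t % 4 = 0 := by
  rw [gcd_four_eq] at h
  split_ifs at h <;> omega

theorem re_natCast_pow_mul (p k : ℕ) (z : ℂ) : ((p : ℂ) ^ k * z).re = (p : ℝ) ^ k * z.re := by
  rw [← re_ofReal_mul]; push_cast; rfl

theorem finrank_eq_div {F L : Type*} [Field F] [Field L] [Algebra F L] [FiniteDimensional F L]
    (E : IntermediateField F L) {m t : ℕ} (hm : Module.finrank F L = m)
    (ht : Module.finrank F E = t) : Module.finrank E L = m / t := by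
  rw [← hm, ← ht, ← Module.finrank_mul_finrank F E L,
    Nat.mul_div_cancel_left _ Module.finrank_pos]

end Parameters

/-! ### The tables of the values `N_t` -/

section Characters

variable {p : ℕ} [Fact p.Prime] {g : (ZMod p)ˣ} {χ : MulChar (ZMod p) ℂ}
variable (hg : ∀ x : (ZMod p)ˣ, x ∈ Subgroup.zpowers g) (hχ : χ (g : ZMod p) = I)
include hg hχ

theorem quadChar_neg_inv (b : ZMod p) : quadChar p (-b⁻¹) = quadChar p b := by
  apply Complex.ofReal_injective
  rw [quadChar_eq hg hχ, quadChar_eq hg hχ, neg_eq_neg_one_mul, map_mul, ← MulChar.inv_apply',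
    MulChar.pow_apply' χ two_ne_zero (-1), ← map_pow, neg_one_sq, map_one, one_mul]
  congr 1
  rw [inv_eq_iff_mul_eq_one, ← pow_add]
  exact pow_four_eq_one hg hχ

omit hg hχ in
theorem conj_char_inv (b : ZMod p) : conj (χ b⁻¹) = χ b := by
  rw [← MulChar.inv_apply']
  have := MulChar.star_apply' χ⁻¹ b
  rwa [inv_inv] at this

end Characters

section Tables

variable {p : ℕ} [Fact p.Prime] {g : (ZMod p)ˣ} {χ : MulChar (ZMod p) ℂ}
variable {L : Type*} [Field L] [Algebra (ZMod p) L] [FiniteDimensional (ZMod p) L]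
variable (hp : p % 4 = 1) (hg : ∀ x : (ZMod p)ˣ, x ∈ Subgroup.zpowers g)
  (hχ : χ (g : ZMod p) = I)
variable (E : IntermediateField (ZMod p) L) [Fintype E]

variable {m t h i₀ : ℕ} (a : ZMod p) (hm : Module.finrank (ZMod p) L = m)
  (ht : Module.finrank (ZMod p) E = t) (hpn : ¬ p ∣ m / t) (hi : IsIndexZero m t 4 h i₀)
include hg hχ hm ht hpn hi

theorem four_mul_count_of_odd (hn : m / t % 2 = 1) :
    4 * (traceNormCount g E a 4 h : ℂ) =
      traceFibreSum E 1 (a / (m / t : ℕ)) + (-1) ^ i₀ *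
        (traceFibreSum E (χ ^ 2) (a / (m / t : ℕ)) +
          2 * ((traceFibreSum E χ (a / (m / t : ℕ)) * I ^ i₀).re : ℂ)) := by
  have hnf := finrank_eq_div E hm ht
  have hn0 : ((Module.finrank E L : ℕ) : ZMod p) ≠ 0 := by
    rwa [Ne, ZMod.natCast_eq_zero_iff, hnf]
  have hd : dParam m t 4 = 1 := by rw [dParam, gcd_four_eq, if_pos hn]
  obtain ⟨-, hi⟩ := hi
  rw [hd, one_mul, Nat.div_one, Nat.div_one] at hi
  rw [four_mul_traceNormCount hg hχ E a h hn0, hnf, sum_fibres_odd hg hχ hn hi]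

theorem two_mul_count_of_two_mod_four (hn : m / t % 4 = 2) (hdh : dParam m t 4 ∣ h) :
    2 * (traceNormCount g E a 4 h : ℂ) =
      traceFibreSum E 1 (a / (m / t : ℕ)) + (-1) ^ i₀ *
        traceFibreSum E (χ ^ 2) (a / (m / t : ℕ)) := by
  have hnf := finrank_eq_div E hm ht
  have hn0 : ((Module.finrank E L : ℕ) : ZMod p) ≠ 0 := by
    rwa [Ne, ZMod.natCast_eq_zero_iff, hnf]
  have hd : dParam m t 4 = 2 := by rw [dParam, gcd_four_eq, if_neg (by omega), if_pos hn]
  obtain ⟨-, hi⟩ := hi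
  rw [hd] at hdh
  rw [hd, mul_comm 2 t, ← Nat.div_div_eq_div_mul] at hi
  have := four_mul_traceNormCount hg hχ E a h hn0
  rw [hnf, sum_fibres_two_mod_four hg hχ hn (Nat.mod_eq_zero_of_dvd hdh) hi] at this
  linear_combination this / 2

omit hi in
theorem count_of_zero_mod_four (hn : m / t % 4 = 0) (hdh : dParam m t 4 ∣ h) (hh : h < 4) :
    (traceNormCount g E a 4 h : ℂ) = traceFibreSum E 1 (a / (m / t : ℕ)) := by
  have hnf := finrank_eq_div E hm ht
  have hn0 : ((Module.finrank E L : ℕ) : ZMod p) ≠ 0 := by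
    rwa [Ne, ZMod.natCast_eq_zero_iff, hnf]
  have hd : dParam m t 4 = 4 := by
    rw [dParam, gcd_four_eq, if_neg (by omega), if_neg (by omega)]
  rw [hd] at hdh
  obtain rfl : h = 0 := by omega
  have := four_mul_traceNormCount hg hχ E a 0 hn0
  rw [hnf, sum_fibres_zero_mod_four hg hχ hn] at this
  linear_combination this / 4

include hp

theorem tableZero_traceNormCount (hdh : dParam m t 4 ∣ h) (hh : h < 4) :
    TableZero p t i₀ (dParam m t 4) (lParam m t 4) (jacobiSum χ χ)
      (traceNormCount g E 0 4 h : ℝ) := by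
  have h0 : (0 : ZMod p) / (m / t : ℕ) = 0 := zero_div _
  have hone := traceFibreSum_one (F := ZMod p) (E := E) 0
  rw [if_pos rfl, ZMod.card, ht] at hone
  have htpos : 0 < t := ht ▸ Module.finrank_pos
  have hodd := four_mul_count_of_odd hg hχ E 0 hm ht hpn hi
  have htwo := fun hn => two_mul_count_of_two_mod_four hg hχ E 0 hm ht hpn hi hn hdh
  have hfour := fun hn => count_of_zero_mod_four hg hχ E 0 hm ht hpn hn hdh hh
  rw [h0, hone] at hodd htwo hfour
  refine ⟨fun hdl => ?_, fun hdl => ?_, fun hdl => ?_, fun hdl => ?_, fun hdl => ?_, fun hdl => ?_⟩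
    <;> apply Complex.ofReal_injective <;> push_cast
  · obtain ⟨hn, hl⟩ := params_eq_one hdl
    have ht2 := gcd_four_eq_one hl
    have hN := hodd hn
    rw [traceFibreSum_sq_zero_of_odd hg hχ (by omega),
      traceFibreSum_zero_of_not_dvd hg hχ (by omega)] at hN
    simp only [zero_mul, Complex.zero_re, Complex.ofReal_zero] at hN
    linear_combination hN / 4
  · obtain ⟨hn, hl⟩ := params_eq_one hdl
    have ht2 := gcd_four_eq_two hl
    have hN := hodd hn
    rw [traceFibreSum_sq_of_even hp hg hχ 0 (k := (t - 2) / 2) (by omega), if_pos rfl,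
      traceFibreSum_zero_of_not_dvd hg hχ (by omega)] at hN
    simp only [zero_mul, Complex.zero_re, Complex.ofReal_zero] at hN
    linear_combination hN / 4
  · obtain ⟨hn, hl⟩ := params_eq_one hdl
    have ht2 := gcd_four_eq_four hl
    have hN := hodd hn
    obtain ⟨k, hk⟩ : ∃ k, t = 4 * k + 4 := ⟨(t - 4) / 4, by omega⟩
    rw [traceFibreSum_sq_of_even hp hg hχ 0 (k := 2 * k + 1) (by omega), if_pos rfl,
      traceFibreSum_of_zero_mod_four hp hg hχ 0 (k := k) (by omega), if_pos rfl] at hN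
    have hre : (-((p : ℂ) ^ k * jacobiSum χ χ ^ (2 * k + 2) * (p - 1)) * I ^ i₀).re =
        -((p : ℝ) ^ k * (p - 1)) * (jacobiSum χ χ ^ (2 * k + 2) * I ^ i₀).re := by
      rw [← re_ofReal_mul]
      push_cast
      ring_nf
    rw [hre] at hN
    push_cast at hN
    rw [show (t - 4) / 4 = k by omega, show t / 4 = k + 1 by omega,
      show t / 2 = 2 * k + 2 by omega]
    linear_combination hN / 4
  · obtain ⟨hn, hl⟩ := params_eq_two hdl
    have ht2 : t % 2 = 1 := by
      rw [gcd_two_eq] at hl; split_ifs at hl <;> omega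
    have hN := htwo hn
    rw [traceFibreSum_sq_zero_of_odd hg hχ (by omega)] at hN
    linear_combination hN / 2
  · obtain ⟨hn, hl⟩ := params_eq_two hdl
    have ht2 : t % 2 = 0 := by
      rw [gcd_two_eq] at hl; split_ifs at hl <;> omega
    have hN := htwo hn
    rw [traceFibreSum_sq_of_even hp hg hχ 0 (k := (t - 2) / 2) (by omega), if_pos rfl] at hN
    linear_combination hN / 2
  · exact hfour (params_eq_four hdl)

theorem tableNonzero_traceNormCount (ha : a ≠ 0) (hdh : dParam m t 4 ∣ h) (hh : h < 4) :
    TableNonzero p χ (-(((m / t : ℕ) : ZMod p) / a)) t i₀ (dParam m t 4) (lParam m t 4)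
      (jacobiSum χ χ) (traceNormCount g E a 4 h : ℝ) := by
  have hn0 : ((m / t : ℕ) : ZMod p) ≠ 0 := by rwa [Ne, ZMod.natCast_eq_zero_iff]
  have hodd := four_mul_count_of_odd hg hχ E a hm ht hpn hi
  have htwo := fun hn => two_mul_count_of_two_mod_four hg hχ E a hm ht hpn hi hn hdh
  have hfour := fun hn => count_of_zero_mod_four hg hχ E a hm ht hpn hn hdh hh
  have hb : a / ((m / t : ℕ) : ZMod p) ≠ 0 := div_ne_zero ha hn0
  rw [← inv_div a]
  generalize a / ((m / t : ℕ) : ZMod p) = b at *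
  have hone := traceFibreSum_one (F := ZMod p) (E := E) b
  rw [if_neg hb, ZMod.card, ht, sub_zero] at hone
  have htpos : 0 < t := ht ▸ Module.finrank_pos
  rw [hone] at hodd htwo hfour
  have hρ : (quadChar p (-b⁻¹) : ℂ) = (χ ^ 2) b := by
    rw [quadChar_neg_inv hg hχ, quadChar_eq hg hχ]
  refine ⟨fun hdl => ?_, fun hdl => ?_, fun hdl => ?_, fun hdl => ?_, fun hdl => ?_, fun hdl => ?_⟩
    <;> apply Complex.ofReal_injective <;> push_cast
  · obtain ⟨hn, hl⟩ := params_eq_one hdl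
    have ht2 := gcd_four_eq_one hl
    have hN := hodd hn
    have hQ : traceFibreSum E χ b * I ^ i₀ = quarticQ p χ (jacobiSum χ χ) t i₀ (-b⁻¹) := by
      rw [quarticQ, neg_neg, ← MulChar.inv_apply']
      split_ifs with h4
      · rw [traceFibreSum_of_one_mod_four hp hg hχ hb (k := (t - 1) / 4) (by omega),
          show (t - 1) / 2 = 2 * ((t - 1) / 4) by omega]
        congr 2
        rw [MulChar.inv_apply', conj_char_inv]
      · rw [traceFibreSum_of_three_mod_four hp hg hχ hb (k := (t - 3) / 4) (by omega),
          show (t + 1) / 2 = 2 * ((t - 3) / 4) + 2 by omega]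
    rw [traceFibreSum_sq_of_odd hp hg hχ hb (k := (t - 1) / 2) (by omega), hQ] at hN
    rw [hρ]
    linear_combination hN / 4
  · obtain ⟨hn, hl⟩ := params_eq_one hdl
    have ht2 := gcd_four_eq_two hl
    have hN := hodd hn
    obtain ⟨k, hk⟩ : ∃ k, t = 4 * k + 2 := ⟨(t - 2) / 4, by omega⟩
    rw [traceFibreSum_sq_of_even hp hg hχ b (k := 2 * k) (by omega), if_neg hb,
      traceFibreSum_of_two_mod_four hp hg hχ hb (k := k) (by omega)] at hN
    have hre : (-((p : ℂ) ^ k * jacobiSum χ χ ^ (2 * k + 1) * (χ ^ 2) b) * I ^ i₀).re =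
        -((p : ℝ) ^ k * quadChar p (-b⁻¹)) * (jacobiSum χ χ ^ (2 * k + 1) * I ^ i₀).re := by
      rw [← re_ofReal_mul, ← hρ]
      push_cast
      ring_nf
    rw [hre] at hN
    push_cast at hN
    rw [show (t - 2) / 4 = k by omega, show t / 2 = 2 * k + 1 by omega]
    linear_combination hN / 4
  · obtain ⟨hn, hl⟩ := params_eq_one hdl
    have ht2 := gcd_four_eq_four hl
    have hN := hodd hn
    obtain ⟨k, hk⟩ : ∃ k, t = 4 * k + 4 := ⟨(t - 4) / 4, by omega⟩
    rw [traceFibreSum_sq_of_even hp hg hχ b (k := 2 * k + 1) (by omega), if_neg hb,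
      traceFibreSum_of_zero_mod_four hp hg hχ b (k := k) (by omega), if_neg hb, mul_assoc,
      re_natCast_pow_mul] at hN
    push_cast at hN
    rw [show (t - 4) / 4 = k by omega, show t / 4 = k + 1 by omega,
      show t / 2 = 2 * k + 2 by omega]
    linear_combination hN / 4
  · obtain ⟨hn, hl⟩ := params_eq_two hdl
    have ht2 : t % 2 = 1 := by
      rw [gcd_two_eq] at hl; split_ifs at hl <;> omega
    have hN := htwo hn
    rw [traceFibreSum_sq_of_odd hp hg hχ hb (k := (t - 1) / 2) (by omega)] at hN
    rw [hρ]
    linear_combination hN / 2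
  · obtain ⟨hn, hl⟩ := params_eq_two hdl
    have ht2 : t % 2 = 0 := by
      rw [gcd_two_eq] at hl; split_ifs at hl <;> omega
    have hN := htwo hn
    rw [traceFibreSum_sq_of_even hp hg hχ b (k := (t - 2) / 2) (by omega), if_neg hb] at hN
    linear_combination hN / 2
  · exact hfour (params_eq_four hdl)

end Tables

/-! ### Irreducible polynomials of prime degree -/

section Irreducibles

open IntermediateField

open Classical in
/-- Counting the elements of an extension `L` of prime degree `m` by their minimal polynomials:
those outside the base field are the roots of irreducible polynomials of degree `m`. -/
theorem mul_irredCount_add_traceNormCount_bot {F L : Type*} [Field F] [Finite F] [Field L]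
    [Finite L] [Algebra F L] (g : Fˣ) {m : ℕ} (hm : m.Prime) (hL : Module.finrank F L = m)
    (a : F) (s h : ℕ) :
    m * irredCount g m a s h + traceNormCount g (⊥ : IntermediateField F L) a s h =
      traceNormCount g (⊤ : IntermediateField F L) a s h := by
  have : Fintype L := Fintype.ofFinite L
  have : Module.Finite F L := Module.Finite.of_finite
  set φ : F[X] → Prop := fun P => P.natDegree = m ∧ P.coeff (m - 1) = -a ∧
    ∃ b ∈ powCoset g s h, P.coeff 0 = (-1) ^ m * b with hφ
  have hcount : (m : ℤ) * irredCount g m a s h = {x : L | φ (minpoly F x)}.ncard := by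
    have h1 := sum_comp_minpoly (E := L) (fun P : F[X] => if φ P then (1 : ℤ) else 0)
    have h2 : {f : F[X] | f.Monic ∧ f.natDegree = m ∧ Irreducible f ∧ f.coeff (m - 1) = -a ∧
        ∃ b ∈ powCoset g s h, f.coeff 0 = (-1) ^ m * b} =
        ((irredsUpTo F m).filter φ : Finset F[X]) := by
      ext f
      simp only [Set.mem_ofPred_eq, Finset.coe_filter, mem_irredsUpTo, hφ]
      constructor
      · rintro ⟨h1, h2, h3, h4⟩
        exact ⟨⟨h1, h3, h2.le⟩, h2, h4⟩
      · rintro ⟨⟨h1, h3, -⟩, h2, h4⟩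
        exact ⟨h1, h2, h3, h4⟩
    have h3 : {x : L | φ (minpoly F x)} =
        (Finset.univ.filter fun x : L => φ (minpoly F x) : Finset L) := by simp
    rw [irredCount, h2, h3, Set.ncard_coe_finset, Set.ncard_coe_finset, Finset.card_filter,
      Finset.card_filter]
    push_cast
    rw [h1, hL, Finset.mul_sum]
    refine Finset.sum_congr rfl fun P _ => ?_
    by_cases hP : φ P
    · rw [if_pos hP, hP.1, if_pos dvd_rfl]
    · simp only [if_neg hP, mul_zero, ite_self]
      exact mul_eq_zero_of_right (m : ℤ) (if_neg hP)
  have hchar : ∀ x : L, (minpoly F x).natDegree = m → (φ (minpoly F x) ↔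
      Algebra.trace F L x = a ∧ Algebra.norm F x ∈ powCoset g s h) := by
    intro x hx
    have hsgn : ((-1 : F) ^ m) * (-1) ^ m = 1 := by rw [← mul_pow]; simp
    rw [trace_eq_mul_nextCoeff_minpoly, norm_eq_coeff_zero_minpoly_pow, hL, hx,
      Nat.div_self hm.pos, pow_one, Nat.cast_one, one_mul,
      nextCoeff_of_natDegree_pos (by rw [hx]; exact hm.pos), hx]
    simp only [hφ, hx, true_and]
    refine and_congr neg_eq_iff_eq_neg.symm ⟨?_, fun hb => ⟨_, hb, ?_⟩⟩
    · rintro ⟨b, hb, h⟩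
      rwa [h, ← mul_assoc, hsgn, one_mul]
    · rw [← mul_assoc, hsgn, one_mul]
  have hbot : ∀ x : L, x ∈ (⊥ : IntermediateField F L) ↔ (minpoly F x).natDegree ≠ m := by
    intro x
    rw [mem_bot]
    change x ∈ (algebraMap F L).range ↔ _
    rw [← minpoly.natDegree_eq_one_iff]
    have hdvd := minpoly.degree_dvd (.of_finite F x : IsIntegral F x)
    rw [hL] at hdvd
    rcases (Nat.dvd_prime hm).1 hdvd with h | h
    · simp [h, hm.one_lt.ne]
    · simp [h, hm.one_lt.ne']
  have hunion : traceNormSet g (⊤ : IntermediateField F L) a s h =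
      {x : L | φ (minpoly F x)} ∪ traceNormSet g (⊥ : IntermediateField F L) a s h := by
    ext x
    simp only [traceNormSet, Set.mem_ofPred_eq, Set.mem_union, mem_top, true_and, hbot]
    by_cases hx : (minpoly F x).natDegree = m
    · rw [hchar x hx]; simp [hx]
    · simp [hφ, hx]
  have hdisj : Disjoint {x : L | φ (minpoly F x)}
      (traceNormSet g (⊥ : IntermediateField F L) a s h) := by
    rw [Set.disjoint_left]
    intro x hx hx'
    exact (hbot x).1 hx'.1 hx.1
  rw [traceNormCount, traceNormCount, hunion, Set.ncard_union_eq hdisj]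
  congr 1
  exact_mod_cast hcount

variable {p : ℕ} [Fact p.Prime] {g : (ZMod p)ˣ} {χ : MulChar (ZMod p) ℂ}

/-- In degree `p` the trace vanishes on the prime field, so that only `a = 0` occurs there. -/
theorem traceNormCount_bot_of_finrank_eq
    (hg : ∀ x : (ZMod p)ˣ, x ∈ Subgroup.zpowers g)
    (hχ : χ (g : ZMod p) = I) {L : Type*} [Field L] [Algebra (ZMod p) L]
    (hL : Module.finrank (ZMod p) L = p) (a : ZMod p) (h : ℕ) :
    4 * traceNormCount g (⊥ : IntermediateField (ZMod p) L) a 4 h =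
      if a = 0 then p - 1 else 0 := by
  classical
  have htr : ∀ y : ZMod p, Algebra.trace (ZMod p) L (algebraMap (ZMod p) L y) = 0 := by
    intro y
    rw [Algebra.trace_algebraMap, hL, nsmul_eq_mul, CharP.cast_eq_zero, zero_mul]
  have hno : ∀ y : ZMod p, Algebra.norm (ZMod p) (algebraMap (ZMod p) L y) = y := by
    intro y
    rw [Algebra.norm_algebraMap, hL, ZMod.pow_card]
  have hset : traceNormSet g (⊥ : IntermediateField (ZMod p) L) a 4 h =
      algebraMap (ZMod p) L '' {y | a = 0 ∧ χ y = I ^ h} := by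
    ext x
    simp only [traceNormSet, Set.mem_ofPred_eq, Set.mem_image, mem_bot, Set.mem_range,
      mem_powCoset_four_iff hg hχ]
    constructor
    · rintro ⟨⟨y, rfl⟩, h1, h2⟩
      rw [htr] at h1
      rw [hno] at h2
      exact ⟨y, ⟨h1.symm, h2⟩, rfl⟩
    · rintro ⟨y, ⟨h1, h2⟩, rfl⟩
      exact ⟨⟨y, rfl⟩, by rw [htr, h1], by rwa [hno]⟩
  rw [traceNormCount, hset, Set.ncard_image_of_injective _ (algebraMap (ZMod p) L).injective]
  split_ifs with ha
  · have h1 : {y : ZMod p | a = 0 ∧ χ y = I ^ h} =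
        (Finset.univ.filter fun y : ZMod p => χ y = I ^ h : Finset (ZMod p)) := by
      ext; simp [ha]
    rw [h1, Set.ncard_coe_finset]
    obtain ⟨h2, h3, h4⟩ := quarticChar_pow_ne_one hχ
    have h5 : (4 : ℂ) * (Finset.univ.filter fun y : ZMod p => χ y = I ^ h).card =
        ∑ y : ZMod p, ∑ j ∈ Finset.range 4, I ^ (3 * h * j) * (χ ^ j) y := by
      simp only [sum_pow_mul_I_pow hg hχ]
      rw [← Finset.sum_filter, Finset.sum_const, nsmul_eq_mul, mul_comm]
    rw [Finset.sum_comm] at h5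
    simp only [← Finset.mul_sum] at h5
    simp only [Finset.sum_range_succ, Finset.sum_range_zero, pow_zero, pow_one,
      MulChar.sum_eq_zero_of_ne_one h2, MulChar.sum_eq_zero_of_ne_one h3,
      MulChar.sum_eq_zero_of_ne_one h4, mul_zero, add_zero, zero_add, one_mul,
      MulChar.sum_one_eq_card_units, ZMod.card_units] at h5
    exact_mod_cast h5
  · simp [ha]

variable (hp : p % 4 = 1) (hg : ∀ x : (ZMod p)ˣ, x ∈ Subgroup.zpowers g)
  (hχ : χ (g : ZMod p) = I)
include hp hg hχ

/-- For `E = L` the parameters are `d = l = 1` and `i₀ = h`. -/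
theorem traceNormCount_top {L : Type*} [Field L] [Algebra (ZMod p) L]
    [FiniteDimensional (ZMod p) L] {m : ℕ}
    (hL : Module.finrank (ZMod p) L = m) (hm : m % 2 = 1) (a : ZMod p) {h : ℕ} (hh : h < 4) :
    (traceNormCount g (⊤ : IntermediateField (ZMod p) L) a 4 h : ℝ) =
      if a = 0 then 1 / 4 * ((p : ℝ) ^ (m - 1) - 1)
      else 1 / 4 * ((p : ℝ) ^ (m - 1) + (-1) ^ h * ((p : ℝ) ^ ((m - 1) / 2) * quadChar p a +
        2 * (quarticQ p χ (jacobiSum χ χ) m h (-a⁻¹)).re)) := by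
  have hmpos : 0 < m := by omega
  have : Finite L := Module.finite_of_finite (ZMod p)
  have : Fintype (⊤ : IntermediateField (ZMod p) L) := Fintype.ofFinite _
  have ht : Module.finrank (ZMod p) (⊤ : IntermediateField (ZMod p) L) = m := by
    rw [finrank_top', hL]
  have hd : dParam m m 4 = 1 := by rw [dParam, Nat.div_self hmpos]; rfl
  have hl : lParam m m 4 = 1 := by rw [lParam, hd, Nat.div_one, gcd_four_eq, if_pos hm]
  have hi : IsIndexZero m m 4 h h := by
    rw [IsIndexZero, hd, one_mul, Nat.div_self hmpos, one_mul]
    exact ⟨by simpa using hh, by rw [Nat.div_one, Nat.div_one]⟩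
  have hpn : ¬ p ∣ m / m := by
    rw [Nat.div_self hmpos]; exact (Fact.out : p.Prime).one_lt.ne' ∘ Nat.dvd_one.1
  split_ifs with ha
  · subst ha
    exact (tableZero_traceNormCount hp hg hχ _ hL ht hpn hi (by rw [hd]; exact one_dvd _) hh).1
      (by rw [hd, hl])
  · have := (tableNonzero_traceNormCount hp hg hχ _ a hL ht hpn hi ha
      (by rw [hd]; exact one_dvd _) hh).1 (by rw [hd, hl])
    rw [this, Nat.div_self hmpos, Nat.cast_one, one_div a, quadChar_neg_inv hg hχ]

/-- For the prime field, the row `(1, 1)` of the tables at `t = 1`, with `χ(a / m)` written as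
`χ(m ^ 3 a)`. -/
theorem traceNormCount_bot_of_finrank_ne {L : Type*} [Field L] [Algebra (ZMod p) L]
    [FiniteDimensional (ZMod p) L] {m : ℕ}
    (hL : Module.finrank (ZMod p) L = m) (hm : m % 2 = 1) (hpm : ¬ p ∣ m) (a : ZMod p)
    {h : ℕ} (hh : h < 4) :
    (traceNormCount g (⊥ : IntermediateField (ZMod p) L) a 4 h : ℝ) =
      if a = 0 then 0
      else 1 / 4 * (1 + (-1) ^ h * (quadChar p a * quadChar p (m : ZMod p) +
        2 * (χ ((m : ZMod p) ^ 3 * a) * I ^ (if m % 4 = 1 then h else 3 * h)).re)) := by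
  have hmpos : 0 < m := by omega
  have : Finite L := Module.finite_of_finite (ZMod p)
  have : Fintype (⊥ : IntermediateField (ZMod p) L) := Fintype.ofFinite _
  have ht : Module.finrank (ZMod p) (⊥ : IntermediateField (ZMod p) L) = 1 :=
    IntermediateField.finrank_bot
  have hd : dParam m 1 4 = 1 := by rw [dParam, Nat.div_one, gcd_four_eq, if_pos hm]
  have hl : lParam m 1 4 = 1 := by rw [lParam, Nat.gcd_one_left]
  -- The solution of `m i₀ ≡ h (mod 4)` is `m h`, as `m ^ 2 ≡ 1 (mod 8)`.
  have hi0 : m % 4 = 1 ∧ m * h % 4 = h % 4 ∨ m % 4 = 3 ∧ m * h % 4 = 3 * h % 4 := by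
    have h4 : m % 4 = 1 ∨ m % 4 = 3 := by omega
    rcases h4 with h4 | h4 <;> simp [Nat.mul_mod, h4]
  have hi : IsIndexZero m 1 4 h (m * h % 4) := by
    rw [IsIndexZero, hd, one_mul, Nat.div_one, Nat.div_one, Nat.div_one]
    refine ⟨Nat.mod_lt _ (by norm_num), ?_⟩
    rw [Nat.ModEq, Nat.mul_mod]
    rcases hi0 with ⟨h1, h2⟩ | ⟨h1, h2⟩ <;> rw [h1, h2] <;> omega
  have hpn : ¬ p ∣ m / 1 := by rwa [Nat.div_one]
  have hdh : dParam m 1 4 ∣ h := by rw [hd]; exact one_dvd _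
  by_cases ha : a = 0
  · subst ha
    have := (tableZero_traceNormCount hp hg hχ _ hL ht hpn hi hdh hh).1 (by rw [hd, hl])
    rw [this, if_pos rfl]; simp
  · have := (tableNonzero_traceNormCount hp hg hχ _ a hL ht hpn hi ha hdh hh).1 (by rw [hd, hl])
    have hρ : quadChar p (-((m : ZMod p) / a)) = quadChar p a * quadChar p (m : ZMod p) := by
      have hinv : ∀ x : ZMod p, quadChar p x⁻¹ = quadChar p x := fun x => by
        rw [quadChar, quadChar, ← MulChar.inv_apply', (quadraticChar_isQuadratic (ZMod p)).inv]
      rw [← inv_div, quadChar_neg_inv hg hχ, div_eq_mul_inv, ← hinv (m : ZMod p)]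
      simp only [quadChar, map_mul, Int.cast_mul]
    have hχm : conj (χ ((m : ZMod p) / a)) = χ ((m : ZMod p) ^ 3 * a) := by
      rw [← inv_div, conj_char_inv, div_eq_mul_inv, map_mul, map_mul, map_pow,
        ← MulChar.inv_apply', char_inv_eq_pow_three hg hχ, MulChar.pow_apply' _ (by norm_num),
        mul_comm]
    have hsgn : (-1 : ℝ) ^ (m * h % 4) = (-1) ^ h := by
      rw [neg_one_pow_eq_pow_mod_two, neg_one_pow_eq_pow_mod_two (n := h)]
      congr 1
      rcases hi0 with ⟨-, h2⟩ | ⟨-, h2⟩ <;> omega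
    have hI : I ^ (m * h % 4) = I ^ (if m % 4 = 1 then h else 3 * h) := by
      rw [I_pow_eq_I_pow_iff, Nat.ModEq]
      rcases hi0 with ⟨h1, h2⟩ | ⟨h1, h2⟩
      · rw [if_pos h1]; omega
      · rw [if_neg (by omega)]; omega
    rw [this, Nat.div_one, quarticQ, if_pos rfl, neg_neg, hρ, hχm, hsgn, hI, if_neg ha]
    simp only [Nat.sub_self, Nat.zero_div, pow_zero, one_mul]

end Irreducibles

theorem mainTheorem2 (p : ℕ) [Fact p.Prime] (hp : p % 4 = 1)
    (g : (ZMod p)ˣ) (hg : ∀ x : (ZMod p)ˣ, x ∈ Subgroup.zpowers g)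
    (χ : MulChar (ZMod p) ℂ) (hχ : χ (g : ZMod p) = I)
    (a₄ b₄ : ℤ) (hab : a₄ ^ 2 + b₄ ^ 2 = (p : ℤ)) (ha₄ : a₄ ≡ -legendreSym p 2 [ZMOD 4])
    (hb₄ : (b₄ : ZMod p) = (a₄ : ZMod p) * (g : ZMod p) ^ ((p - 1) / 4))
    (m : ℕ) (hm : 2 ≤ m) (a : ZMod p) (h : ℕ) (hh : h < 4) :
    -- the values of `N_t` for every `t ∣ m`
    (∀ (L : Type*) [Field L] [Algebra (ZMod p) L], Module.finrank (ZMod p) L = m →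
      ∀ t : ℕ, t ∣ m → ∀ E : IntermediateField (ZMod p) L, Module.finrank (ZMod p) E = t →
      ¬ p ∣ m / t → dParam m t 4 ∣ h →
      ∀ i₀ : ℕ, IsIndexZero m t 4 h i₀ →
        (dParam m t 4, lParam m t 4) ∈
          ({(1, 1), (1, 2), (1, 4), (2, 1), (2, 2), (4, 1)} : Set (ℕ × ℕ)) ∧
        (a = 0 → TableZero p t i₀ (dParam m t 4) (lParam m t 4) (quarticPi p a₄ b₄)
          (traceNormCount g E a 4 h : ℝ)) ∧
        -- here `a₀ = -m / (t a)`, where `m / t` is an integer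
        (a ≠ 0 → TableNonzero p χ (-(((m / t : ℕ) : ZMod p) / a)) t i₀
          (dParam m t 4) (lParam m t 4) (quarticPi p a₄ b₄)
          (traceNormCount g E a 4 h : ℝ))) ∧
    -- the values of `P_m(a, 4, h)` for prime `m > 2`
    (m.Prime → 2 < m →
      (a = 0 → m = p → (irredCount g m a 4 h : ℝ) = 1 / 4 * ((p : ℝ) ^ (p - 2) - 1)) ∧
      (a = 0 → m ≠ p → (irredCount g m a 4 h : ℝ) = 1 / (4 * m) * ((p : ℝ) ^ (m - 1) - 1)) ∧
      (a ≠ 0 → m = p → (irredCount g m a 4 h : ℝ) =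
        1 / (4 * p) * ((p : ℝ) ^ (p - 1) + (-1) ^ h *
          ((p : ℝ) ^ ((p - 1) / 2) * quadChar p a + 2 * (p : ℝ) ^ ((p - 1) / 4) *
            (quarticPi p a₄ b₄ ^ ((p - 1) / 2) * χ a * I ^ h).re))) ∧
      (a ≠ 0 → m ≠ p → (irredCount g m a 4 h : ℝ) =
        1 / (4 * m) * ((p : ℝ) ^ (m - 1) - 1 + (-1) ^ h *
          (quadChar p a * ((p : ℝ) ^ ((m - 1) / 2) - quadChar p (m : ZMod p)) +
            2 * (quarticR p χ (quarticPi p a₄ b₄) m h a).re)))) := by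
  rw [← jacobiSum_eq_quarticPi hp hg hχ hab ha₄ hb₄]
  refine ⟨?_, ?_⟩
  · intro L _ _ hL t _ E ht hpn hdh i₀ hi
    have : FiniteDimensional (ZMod p) L := Module.finite_of_finrank_pos (by omega)
    have : Finite L := Module.finite_of_finite (ZMod p)
    have : Fintype E := Fintype.ofFinite E
    refine ⟨params_mem m t, ?_, fun ha =>
      tableNonzero_traceNormCount hp hg hχ E a hL ht hpn hi ha hdh hh⟩
    rintro rfl
    exact tableZero_traceNormCount hp hg hχ E hL ht hpn hi hdh hh
  · intro hmp hm2
    have hL : Module.finrank (ZMod p) (GaloisField p m) = m := GaloisField.finrank p hmp.ne_zero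
    have hodd : m % 2 = 1 := hmp.eq_two_or_odd.resolve_left hm2.ne'
    have hm0 : (m : ℝ) ≠ 0 := by exact_mod_cast hmp.ne_zero
    have hpp : p.Prime := Fact.out
    have hp0 : (p : ℝ) ≠ 0 := by exact_mod_cast hpp.ne_zero
    have hcount : (m : ℝ) * irredCount g m a 4 h +
        traceNormCount g (⊥ : IntermediateField (ZMod p) (GaloisField p m)) a 4 h =
          traceNormCount g (⊤ : IntermediateField (ZMod p) (GaloisField p m)) a 4 h := by
      exact_mod_cast mul_irredCount_add_traceNormCount_bot g hmp hL a 4 h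
    have key : ∀ X : ℝ, (m : ℝ) * (1 / (4 * m) * X) = X / 4 := fun X => by field_simp
    have htop := traceNormCount_top hp hg hχ hL hodd a hh
    refine ⟨fun ha hmp' => ?_, fun ha hmp' => ?_, fun ha hmp' => ?_, fun ha hmp' => ?_⟩
    · subst hmp'
      have hbot := traceNormCount_bot_of_finrank_eq hg hχ hL a h
      rw [if_pos ha] at hbot htop
      have hbot' : (4 : ℝ) * traceNormCount g
          (⊥ : IntermediateField (ZMod m) (GaloisField m m)) a 4 h = m - 1 := by
        rw [← Nat.cast_pred hmp.pos]
        exact_mod_cast hbot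
      apply mul_left_cancel₀ hm0
      have hpow : (m : ℝ) * m ^ (m - 2) = m ^ (m - 1) := by
        rw [← pow_succ']; congr 1; omega
      linear_combination hcount + htop - hbot' / 4 - hpow / 4
    · have hbot := traceNormCount_bot_of_finrank_ne hp hg hχ hL hodd
        (fun hd => hmp' ((Nat.prime_dvd_prime_iff_eq hpp hmp).1 hd).symm) a hh
      rw [if_pos ha] at hbot htop
      apply mul_left_cancel₀ hm0
      rw [key]
      linear_combination hcount + htop - hbot
    · subst hmp'
      have hbot := traceNormCount_bot_of_finrank_eq hg hχ hL a h
      rw [if_neg ha] at hbot htop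
      have hbot' : (traceNormCount g
          (⊥ : IntermediateField (ZMod m) (GaloisField m m)) a 4 h : ℝ) = 0 := by
        exact_mod_cast (by omega : traceNormCount g
          (⊥ : IntermediateField (ZMod m) (GaloisField m m)) a 4 h = 0)
      rw [quarticQ, if_pos hp, neg_neg, conj_char_inv, mul_assoc, mul_assoc, re_natCast_pow_mul,
        ← mul_assoc (jacobiSum χ χ ^ _)] at htop
      apply mul_left_cancel₀ hm0
      rw [key]
      linear_combination hcount + htop - hbot'
    · have hbot := traceNormCount_bot_of_finrank_ne hp hg hχ hL hodd
        (fun hd => hmp' ((Nat.prime_dvd_prime_iff_eq hpp hmp).1 hd).symm) a hh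
      rw [if_neg ha] at hbot htop
      have hR : (quarticR p χ (jacobiSum χ χ) m h a).re =
          (quarticQ p χ (jacobiSum χ χ) m h (-a⁻¹)).re -
            (χ ((m : ZMod p) ^ 3 * a) * I ^ (if m % 4 = 1 then h else 3 * h)).re := by
        rw [← Complex.sub_re, quarticR, quarticQ, neg_neg]
        split_ifs with h4
        · rw [conj_char_inv]
        · rw [← conj_char_inv (χ := χ) a, Complex.conj_conj]
      rw [hR]
      apply mul_left_cancel₀ hm0
      rw [key]
      linear_combination hcount + htop - hbot
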